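/- Let $I=(a,b)$ with real $a<b$, and let $C_0^1(I)$ be the space of continuously differentiable functions with compact support in $I$. For $u\in L^1(I)$ let $J(u)=\sup\{\int_a^b u\,\xi'\,dx : \xi\in C_0^1(I),\ \|\xi\|_\infty\le 1\}$, and let $BV(I)=\{u\in L^1(I): J(u)<\infty\}$. Let $H_0^1(I)$ be the space of all $\xi\in L^2(I)$ with distributional derivative $\xi'\in L^2(I)$ whose continuous representative on $[a,b]$ vanishes at $a$ and $b$, and let $K=\{\xi\in H_0^1(I):\|\xi\|_\infty\le 1\}$. For $f\in L^2(I)$ and $\lambda>0$ let $u_\lambda$ denote the unique minimizer over $BV(I)$ of the Rudin--Osher--Fatemi functional $$E_\lambda(u)=\lambda J(u)+\tfrac12\|f-u\|_{L^2(I)}^2,$$ and let $\xi_\lambda$ denote the unique maximizer over $K$ of the dual functional $$\xi\mapsto\tfrac12\big(\|f\|_{L^2(I)}^2-\|f-\lambda\xi'\|_{L^2(I)}^2\big).$$ A function on $I$ (considered up to equality almost everywhere) is called piecewise constant if there is a finite partition $a=x_0<x_1<\dots<x_n=b$ such that it is almost everywhere equal to a constant on each $(x_{i-1},x_i)$; a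 function on $[a,b]$ is called piecewise linear if there is such a partition for which it is affine on each $[x_{i-1},x_i]$. **Proposition.** Suppose that $f$ is piecewise constant on $I$. Then, for every $\lambda>0$, the minimizer $u_\lambda$ exists, is unique up to equality almost everywhere, and is piecewise constant. Moreover, there exist a number $\bar\lambda>0$ and a piecewise linear function $\bar\xi\in K$ such that, for every $\lambda$ with $0<\lambda\le\bar\lambda$, the maximizer $\xi_\lambda$ exists, is unique, and equals $\bar\xi$ on $[a,b]$. -/

import Mathlib

open MeasureTheory Set
open scoped ENNReal

noncomputable section

namespace ROF

/-- Functions on `I = (a, b)` are represented by functions `ℝ → ℝ` of which only the restriction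
to `I` (or, for members of `H¹₀(I)`, to `[a, b]`) matters.
`C₀¹(I)`: continuously differentiable functions with compact support contained in `I`
(extended by zero to the real line). -/
def IsTestFunction (a b : ℝ) (φ : ℝ → ℝ) : Prop :=
  ContDiff ℝ 1 φ ∧ HasCompactSupport φ ∧ tsupport φ ⊆ Ioo a b

/-- Membership in `L²(I)`. -/
def MemL2 (a b : ℝ) (u : ℝ → ℝ) : Prop :=
  MemLp u 2 (volume.restrict (Ioo a b))

/-- `g` is the distributional derivative of `u` on `I`. -/
def HasDistribDeriv (a b : ℝ) (u g : ℝ → ℝ) : Prop :=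
  ∀ φ : ℝ → ℝ, IsTestFunction a b φ →
    ∫ x in Ioo a b, u x * deriv φ x = -∫ x in Ioo a b, g x * φ x

/-- Membership in the Sobolev space `H¹(I)`. -/
def MemH1 (a b : ℝ) (u : ℝ → ℝ) : Prop :=
  MemL2 a b u ∧ ∃ g : ℝ → ℝ, MemL2 a b g ∧ HasDistribDeriv a b u g

open Classical in
/-- The distributional derivative in `L²(I)` of a function in `H¹(I)`
(determined almost everywhere on `I`); zero when there is none. -/
def distribDeriv (a b : ℝ) (u : ℝ → ℝ) : ℝ → ℝ :=
  if h : ∃ g : ℝ → ℝ, MemL2 a b g ∧ HasDistribDeriv a b u g then h.choose else 0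

/-- Membership in `H¹₀(I)`, its elements being given by their continuous representative
on `[a, b]`. -/
def MemH10 (a b : ℝ) (ξ : ℝ → ℝ) : Prop :=
  MemH1 a b ξ ∧ ContinuousOn ξ (Icc a b) ∧ ξ a = 0 ∧ ξ b = 0

/-- The convex set `K` of all `ξ ∈ H¹₀(I)` with sup-norm at most one. -/
def K (a b : ℝ) : Set (ℝ → ℝ) :=
  {ξ | MemH10 a b ξ ∧ ∀ x ∈ Icc a b, |ξ x| ≤ 1}

/-- The total variation
`J(u) = sup {∫ u ξ' : ξ ∈ C₀¹(I), ‖ξ‖_∞ ≤ 1} ∈ [0, ∞]`. As `ξ = 0` is admissible, the supremum is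
nonnegative, so that truncating the integrals at zero does not alter it. -/
def totalVariation (a b : ℝ) (u : ℝ → ℝ) : ℝ≥0∞ :=
  ⨆ (ξ : ℝ → ℝ) (_ : IsTestFunction a b ξ ∧ ∀ x, |ξ x| ≤ 1),
    ENNReal.ofReal (∫ x in Ioo a b, u x * deriv ξ x)

/-- The space `BV(I)` of integrable functions of bounded variation. -/
def BV (a b : ℝ) : Set (ℝ → ℝ) :=
  {u | IntegrableOn u (Ioo a b) ∧ totalVariation a b u < ∞}

/-- The Rudin-Osher-Fatemi functional `E_λ(u) = λ J(u) + (1/2) ‖f - u‖²`. -/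
def energy (a b : ℝ) (f : ℝ → ℝ) (lam : ℝ) (u : ℝ → ℝ) : ℝ≥0∞ :=
  ENNReal.ofReal lam * totalVariation a b u
    + 2⁻¹ * ∫⁻ x in Ioo a b, ENNReal.ofReal ((f x - u x) ^ 2)

/-- `u` is the denoised signal `u_λ`: it minimizes `E_λ` over `BV(I)`. -/
def IsDenoised (a b : ℝ) (f : ℝ → ℝ) (lam : ℝ) (u : ℝ → ℝ) : Prop :=
  u ∈ BV a b ∧ IsMinOn (energy a b f lam) (BV a b) u

/-- The dual functional `(1/2) (‖f‖² - ‖f - λ ξ'‖²)`. -/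
def dualEnergy (a b : ℝ) (f : ℝ → ℝ) (lam : ℝ) (ξ : ℝ → ℝ) : ℝ :=
  1 / 2 * ((∫ x in Ioo a b, f x ^ 2)
    - ∫ x in Ioo a b, (f x - lam * distribDeriv a b ξ x) ^ 2)

/-- `ξ` is the dual solution `ξ_λ`: it maximizes the dual functional over `K`. -/
def IsDualSolution (a b : ℝ) (f : ℝ → ℝ) (lam : ℝ) (ξ : ℝ → ℝ) : Prop :=
  ξ ∈ K a b ∧ IsMaxOn (dualEnergy a b f lam) (K a b) ξ

/-- `x` lists the nodes `a = x₀ < x₁ < ⋯ < xₙ = b` of a finite partition of `[a, b]`. -/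
def IsPartition (a b : ℝ) {n : ℕ} (x : Fin (n + 1) → ℝ) : Prop :=
  StrictMono x ∧ x 0 = a ∧ x (Fin.last n) = b

/-- The (almost everywhere class of the) function `u` is piecewise constant on `I`: it is almost
everywhere equal to a constant on each of the finitely many intervals of some partition. -/
def PiecewiseConstant (a b : ℝ) (u : ℝ → ℝ) : Prop :=
  ∃ (n : ℕ) (x : Fin (n + 1) → ℝ) (c : Fin n → ℝ), IsPartition a b x ∧
    ∀ i : Fin n, ∀ᵐ t ∂(volume.restrict (Ioo (x i.castSucc) (x i.succ))), u t = c i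

/-- `ξ` is (continuous and) piecewise linear on `[a, b]`: it is affine on each of the finitely many
closed intervals of some partition. -/
def PiecewiseLinear (a b : ℝ) (ξ : ℝ → ℝ) : Prop :=
  ∃ (n : ℕ) (x : Fin (n + 1) → ℝ) (m k : Fin n → ℝ), IsPartition a b x ∧
    ∀ i : Fin n, ∀ t ∈ Icc (x i.castSucc) (x i.succ), ξ t = m i * t + k i

end ROF

end

/-! ### Grids -/

namespace ROF

/-! Primal problem. Let `f` be a step function on a grid, and replace a competitor `v` by its means
over the grid intervals. By Pythagoras the fidelity term drops by exactly half the squared distance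
of `v` from its averaged version. The total variation does not increase either: pair `v` with the
derivative of the piecewise linear function whose node values are minus the signs of the jumps of
the means. That derivative is a step function, so only the means enter, and summation by parts
returns the sum of the absolute jumps (`ofReal_sum_abs_mean_le`). For step functions this sum is
also an upper bound (`totalVariation_step_le`). Hence the problem reduces to a finite-dimensional
one, which compactness and strict convexity solve uniquely; any other minimizer must agree with its
own averages (`exists_isDenoised_step`).

Dual problem. Maximizing means minimizing `‖f - λ ξ'‖²`. The candidate is the piecewise linear
function whose node values are minus the signs of the jumps of `f`, which does not involve `λ`. With
`u = f - λ ξ'` for this candidate and any competitor `η`, expanding the square leaves the cross term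
`∫ u (ξ' - η')`. Summation by parts turns it into a sum over interior nodes, nonnegative as soon as
no jump of `u` is opposed to the corresponding jump of `f`; this holds for all small `λ`, because
the jumps of `f` are nonzero on a grid without superfluous nodes. The remaining square term gives
uniqueness (`dualEnergy_add_le`, `IsDualSolution.eqOn_linInterp`). -/

/-- The nodes `a = x 0 < x 1 < ⋯ < x n = b` of a partition, as a sequence. -/
structure IsGrid (a b : ℝ) (n : ℕ) (x : ℕ → ℝ) : Prop where
  left : x 0 = a
  right : x n = b
  lt_succ : ∀ i < n, x i < x (i + 1)

namespace IsGrid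

variable {a b : ℝ} {n : ℕ} {x : ℕ → ℝ}

theorem lt (h : IsGrid a b n x) {i j : ℕ} (hij : i < j) (hj : j ≤ n) : x i < x j := by
  induction j, hij using Nat.le_induction with
  | base => exact h.lt_succ i hj
  | succ k hk ih => exact (ih (by omega)).trans (h.lt_succ k (by omega))

theorem le (h : IsGrid a b n x) {i j : ℕ} (hij : i ≤ j) (hj : j ≤ n) : x i ≤ x j := by
  rcases hij.eq_or_lt with rfl | hij
  · exact le_rfl
  · exact (h.lt hij hj).le

theorem left_le (h : IsGrid a b n x) {i : ℕ} (hi : i ≤ n) : a ≤ x i :=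
  h.left ▸ h.le (Nat.zero_le i) hi

theorem le_right (h : IsGrid a b n x) {i : ℕ} (hi : i ≤ n) : x i ≤ b :=
  h.right ▸ h.le hi le_rfl

theorem mem_Icc (h : IsGrid a b n x) {i : ℕ} (hi : i ≤ n) : x i ∈ Icc a b :=
  ⟨h.left_le hi, h.le_right hi⟩

theorem Ioo_subset (h : IsGrid a b n x) {i : ℕ} (hi : i < n) :
    Ioo (x i) (x (i + 1)) ⊆ Ioo a b :=
  Ioo_subset_Ioo (h.left_le hi.le) (h.le_right hi)

theorem exists_mem_Icc (h : IsGrid a b n x) (hn : 0 < n) {t : ℝ} (ht : t ∈ Icc a b) :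
    ∃ k < n, t ∈ Icc (x k) (x (k + 1)) := by
  by_contra! hc
  -- If no interval contains `t`, then `t` is pushed strictly past each node after the first, hence
  -- past `x n = b`.
  have key : ∀ k ≤ n, x k ≤ t ∧ (0 < k → x k < t) := by
    intro k
    induction k with
    | zero => exact fun _ => ⟨h.left ▸ ht.1, fun h0 => absurd h0 (lt_irrefl _)⟩
    | succ k ih =>
      intro hk
      have h2 : x (k + 1) < t := by
        by_contra! h3
        exact hc k hk ⟨(ih (by omega)).1, h3⟩
      exact ⟨h2.le, fun _ => h2⟩
  have := (key n le_rfl).2 hn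
  rw [h.right] at this
  exact absurd ht.2 this.not_ge

theorem ae_exists_mem_Ioo (h : IsGrid a b n x) (hn : 0 < n) :
    ∀ᵐ t ∂(volume.restrict (Ioo a b)), ∃ k < n, t ∈ Ioo (x k) (x (k + 1)) := by
  have h0 : ∀ᵐ t : ℝ, ∀ i : ℕ, t ≠ x i :=
    ae_all_iff.2 fun i => by simp [ae_iff, measure_singleton]
  rw [ae_restrict_iff' measurableSet_Ioo]
  filter_upwards [h0] with t ht hab
  obtain ⟨k, hk, h1, h2⟩ := h.exists_mem_Icc hn (Ioo_subset_Icc_self hab)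
  exact ⟨k, hk, lt_of_le_of_ne h1 (ht k).symm, lt_of_le_of_ne h2 (ht _)⟩

/-- Indices are truncated at `n`, so that nodes can be indexed by `ℕ`; the values beyond `n` play no
role. -/
theorem of_isPartition {x : Fin (n + 1) → ℝ} (h : IsPartition a b x) :
    IsGrid a b n (fun i => x ⟨min i n, by omega⟩) where
  left := by simpa using h.2.1
  right := by
    rw [← h.2.2]; congr 1; ext; simp
  lt_succ i hi := h.1 (by simp [Fin.lt_def]; omega)

theorem isPartition (h : IsGrid a b n x) : IsPartition a b (fun i : Fin (n + 1) => x i) :=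
  ⟨fun i j hij => h.lt hij (Nat.lt_succ_iff.1 j.2), by simpa using h.left, by simpa using h.right⟩

end IsGrid

/-- The step function with value `c i` on `(x i, x (i + 1))` for `i < n`. -/
noncomputable def step (x c : ℕ → ℝ) (n : ℕ) (t : ℝ) : ℝ :=
  ∑ i ∈ Finset.range n, (Ioo (x i) (x (i + 1))).indicator (fun _ => c i) t

/-! ### Step functions and their reduction to genuine jumps -/

section Step

variable {a b : ℝ} {n : ℕ} {x : ℕ → ℝ}

theorem step_apply (h : IsGrid a b n x) (c : ℕ → ℝ) {k : ℕ} (hk : k < n) {t : ℝ}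
    (ht : t ∈ Ioo (x k) (x (k + 1))) : step x c n t = c k := by
  unfold step
  rw [Finset.sum_eq_single_of_mem k (Finset.mem_range.2 hk), indicator_of_mem ht]
  intro i hi hik
  have hi := Finset.mem_range.1 hi
  refine indicator_of_notMem (fun hm => ?_) _
  rcases lt_or_gt_of_ne hik with h1 | h1
  · exact absurd (hm.2.trans_le (h.le h1 hk.le)) ht.1.not_gt
  · exact absurd (ht.2.trans_le (h.le h1 hi.le)) hm.1.not_gt

theorem measurable_step (x c : ℕ → ℝ) (n : ℕ) : Measurable (step x c n) :=
  Finset.measurable_fun_sum _ fun _ _ => measurable_const.indicator measurableSet_Ioo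

theorem abs_step_le (x c : ℕ → ℝ) (n : ℕ) (t : ℝ) :
    |step x c n t| ≤ ∑ i ∈ Finset.range n, |c i| := by
  refine (Finset.abs_sum_le_sum_abs _ _).trans (Finset.sum_le_sum fun i _ => ?_)
  by_cases ht : t ∈ Ioo (x i) (x (i + 1))
  · simp [ht]
  · simp [ht]

theorem memLp_step (a b : ℝ) (x c : ℕ → ℝ) (n : ℕ) (p : ℝ≥0∞) :
    MemLp (step x c n) p (volume.restrict (Ioo a b)) :=
  MemLp.of_bound (measurable_step x c n).aestronglyMeasurable _
    (Filter.Eventually.of_forall fun t => abs_step_le x c n t)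

theorem integrableOn_step (a b : ℝ) (x c : ℕ → ℝ) (n : ℕ) :
    IntegrableOn (step x c n) (Ioo a b) :=
  memLp_one_iff_integrable.1 (memLp_step a b x c n 1)

theorem integrableOn_step_mul (c : ℕ → ℝ) {g : ℝ → ℝ}
    (hg : IntegrableOn g (Ioo a b)) : IntegrableOn (fun t => step x c n t * g t) (Ioo a b) :=
  Integrable.bdd_mul hg (measurable_step x c n).aestronglyMeasurable
    (Filter.Eventually.of_forall fun t => abs_step_le x c n t)

theorem integral_step_mul (h : IsGrid a b n x) (c : ℕ → ℝ) {g : ℝ → ℝ}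
    (hg : IntegrableOn g (Ioo a b)) :
    ∫ t in Ioo a b, step x c n t * g t
      = ∑ i ∈ Finset.range n, c i * ∫ t in (x i)..(x (i + 1)), g t := by
  simp only [step, Finset.sum_mul]
  have e : ∀ i, (fun t => (Ioo (x i) (x (i + 1))).indicator (fun _ => c i) t * g t)
      = (Ioo (x i) (x (i + 1))).indicator (fun t => c i * g t) := by
    intro i; ext t
    by_cases ht : t ∈ Ioo (x i) (x (i + 1)) <;> simp [ht]
  rw [integral_finsetSum]
  · refine Finset.sum_congr rfl fun i hi => ?_
    have hi := Finset.mem_range.1 hi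
    rw [e, integral_indicator measurableSet_Ioo, Measure.restrict_restrict measurableSet_Ioo,
      inter_eq_left.2 (h.Ioo_subset hi), integral_const_mul,
      intervalIntegral.integral_of_le (h.lt_succ i hi).le, integral_Ioc_eq_integral_Ioo]
  · intro i hi
    rw [e]
    exact (hg.const_mul (c i)).indicator measurableSet_Ioo

theorem step_ae_ext (h : IsGrid a b n x) (hn : 0 < n) {u : ℝ → ℝ} {c : ℕ → ℝ}
    (hu : ∀ i < n, ∀ᵐ t ∂(volume.restrict (Ioo (x i) (x (i + 1)))), u t = c i) :
    u =ᵐ[volume.restrict (Ioo a b)] step x c n := by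
  have h1 : ∀ᵐ t : ℝ, ∀ i : ℕ, i < n → t ∈ Ioo (x i) (x (i + 1)) → u t = c i := by
    refine ae_all_iff.2 fun i => ?_
    by_cases hi : i < n
    · have := (ae_restrict_iff' measurableSet_Ioo).1 (hu i hi)
      filter_upwards [this] with t ht _ using ht
    · exact Filter.Eventually.of_forall fun t h => absurd h hi
  filter_upwards [ae_restrict_of_ae h1, h.ae_exists_mem_Ioo hn] with t ht ⟨k, hk, hm⟩
  rw [ht k hk hm, step_apply h c hk hm]

theorem piecewiseConstant_step (h : IsGrid a b n x) (c : ℕ → ℝ) :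
    PiecewiseConstant a b (step x c n) := by
  refine ⟨n, fun i => x i, fun i => c i, h.isPartition, fun i => ?_⟩
  refine (ae_restrict_iff' measurableSet_Ioo).2 (Filter.Eventually.of_forall fun t ht => ?_)
  exact step_apply h c i.2 (by simpa using ht)

/-- A grid on which two neighbouring values of a step function agree has a superfluous node. -/
theorem exists_coarser (h : IsGrid a b (n + 2) x) {c : ℕ → ℝ} {k : ℕ} (hk : k < n + 1)
    (hc : c (k + 1) = c k) {u : ℝ → ℝ} (hu : u =ᵐ[volume.restrict (Ioo a b)] step x c (n + 2)) :
    ∃ x' c', IsGrid a b (n + 1) x' ∧ u =ᵐ[volume.restrict (Ioo a b)] step x' c' (n + 1) := by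
  -- The node `x (k + 1)` is dropped together with the value `c (k + 1)`, merging the intervals
  -- number `k` and `k + 1`.
  let x' : ℕ → ℝ := fun j => if j < k + 1 then x j else x (j + 1)
  let c' : ℕ → ℝ := fun j => if j < k + 1 then c j else c (j + 1)
  have hx' : IsGrid a b (n + 1) x' := by
    refine ⟨by simp [x', h.left], ?_, fun i hi => ?_⟩
    · have : ¬ (n + 1 < k + 1) := by omega
      simp only [x', this, if_false]; exact h.right
    · simp only [x']
      split_ifs
      · exact h.lt (by omega) (by omega)
      · exact h.lt (by omega) (by omega)
      · omega
      · exact h.lt (by omega) (by omega)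
  refine ⟨x', c', hx', ?_⟩
  filter_upwards [hu, h.ae_exists_mem_Ioo (by omega)] with t ht ⟨j, hj, hm⟩
  rw [ht, step_apply h c hj hm]
  rcases lt_trichotomy j (k + 1) with h1 | h1 | h1
  · have hm' : t ∈ Ioo (x' j) (x' (j + 1)) := by
      refine ⟨by simpa only [x', if_pos h1] using hm.1, ?_⟩
      simp only [x']
      split_ifs
      · exact hm.2
      · exact hm.2.trans (h.lt_succ _ (by omega))
    rw [step_apply hx' c' (by omega) hm']
    simp only [c', if_pos h1]
  · subst h1
    have hm' : t ∈ Ioo (x' k) (x' (k + 1)) := by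
      refine ⟨?_, by simpa [x'] using hm.2⟩
      simpa [x'] using (h.lt_succ k (by omega)).trans hm.1
    rw [step_apply hx' c' (by omega) hm', hc]
    simp [c']
  · obtain ⟨j, rfl⟩ : ∃ i, j = i + 1 := ⟨j - 1, by omega⟩
    have hj' : ¬ (j < k + 1) := by omega
    have hj'' : ¬ (j + 1 < k + 1) := by omega
    have hm' : t ∈ Ioo (x' j) (x' (j + 1)) := by
      simpa only [x', hj', hj'', if_false] using hm
    rw [step_apply hx' c' (by omega) hm']
    simp only [c', if_neg hj']

/-- A piecewise constant function is a step function with genuine jumps at all interior nodes. -/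
theorem PiecewiseConstant.exists_step (hab : a < b) {f : ℝ → ℝ} (hf : PiecewiseConstant a b f) :
    ∃ (m : ℕ) (x c : ℕ → ℝ), IsGrid a b (m + 1) x ∧
      f =ᵐ[volume.restrict (Ioo a b)] step x c (m + 1) ∧ ∀ i < m, c (i + 1) ≠ c i := by
  classical
  have hex : ∃ (m : ℕ) (x c : ℕ → ℝ), IsGrid a b (m + 1) x ∧
      f =ᵐ[volume.restrict (Ioo a b)] step x c (m + 1) := by
    obtain ⟨n, x, c, hx, hc⟩ := hf
    have hg := IsGrid.of_isPartition hx
    obtain rfl | ⟨m, rfl⟩ : n = 0 ∨ ∃ m, n = m + 1 := by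
      rcases n with _ | m
      · exact Or.inl rfl
      · exact Or.inr ⟨m, rfl⟩
    · exact absurd (hg.left.symm.trans hg.right) hab.ne
    refine ⟨m, _, fun i => c ⟨min i m, by omega⟩, hg, step_ae_ext hg m.succ_pos fun i hi => ?_⟩
    have e1 : (⟨min i (m + 1), by omega⟩ : Fin (m + 1 + 1)) = (⟨i, hi⟩ : Fin (m + 1)).castSucc :=
      Fin.ext (min_eq_left hi.le)
    have e2 : (⟨min (i + 1) (m + 1), by omega⟩ : Fin (m + 1 + 1)) = (⟨i, hi⟩ : Fin (m + 1)).succ :=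
      Fin.ext (min_eq_left hi)
    have e3 : (⟨min i m, by omega⟩ : Fin (m + 1)) = ⟨i, hi⟩ := Fin.ext (min_eq_left (by omega))
    simp only [e1, e2, e3]
    exact hc ⟨i, hi⟩
  -- A representation with the least number of intervals has no superfluous node.
  obtain ⟨x, c, hx, hfx⟩ := Nat.find_spec hex
  refine ⟨Nat.find hex, x, c, hx, hfx, fun i hi hci => ?_⟩
  obtain ⟨n, hn⟩ : ∃ n, Nat.find hex = n + 1 := ⟨Nat.find hex - 1, by omega⟩
  rw [hn] at hx hfx hi
  exact Nat.find_min hex (m := n) (by omega) (exists_coarser hx hi hci hfx)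

/-! ### Summation by parts and interpolation between nodes -/

/-- Summation by parts. -/
theorem sum_mul_sub_eq (c q : ℕ → ℝ) (m : ℕ) :
    ∑ i ∈ Finset.range (m + 1), c i * (q (i + 1) - q i)
      = c m * q (m + 1) - c 0 * q 0 - ∑ i ∈ Finset.range m, (c (i + 1) - c i) * q (i + 1) := by
  induction m with
  | zero => simp; ring
  | succ m ih => rw [Finset.sum_range_succ, ih, Finset.sum_range_succ _ m]; ring

/-- A cut-off profile `σ` running from `0` to `Z`, put to scale on every interval of the grid, gives
an interpolation of the values `p`. -/
noncomputable def interp (σ : ℝ → ℝ) (x p : ℕ → ℝ) (n : ℕ) (t : ℝ) : ℝ :=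
  ∑ i ∈ Finset.range n, (p (i + 1) - p i) * σ ((t - x i) / (x (i + 1) - x i))

variable {σ : ℝ → ℝ} {Z : ℝ}

/-- Intervals to the left of `t` contribute their full increment times `Z`, which telescopes; those
to the right contribute nothing. -/
theorem interp_apply (h : IsGrid a b n x) (p : ℕ → ℝ) (h0 : ∀ s ≤ 0, σ s = 0)
    (h1 : ∀ s, 1 ≤ s → σ s = Z) {k : ℕ} (hk : k < n) {t : ℝ}
    (ht : t ∈ Icc (x k) (x (k + 1))) :
    interp σ x p n t = Z * (p k - p 0)
      + (p (k + 1) - p k) * σ ((t - x k) / (x (k + 1) - x k)) := by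
  have hpos : ∀ i < n, 0 < x (i + 1) - x i := fun i hi => sub_pos.2 (h.lt_succ i hi)
  have e1 : ∑ i ∈ Finset.range k, (p (i + 1) - p i) * σ ((t - x i) / (x (i + 1) - x i))
      = Z * (p k - p 0) := by
    rw [← Finset.sum_range_sub p k, Finset.mul_sum]
    refine Finset.sum_congr rfl fun i hi => ?_
    have hi := Finset.mem_range.1 hi
    rw [h1 _ ((one_le_div (hpos i (by omega))).2 _), mul_comm]
    have := h.le (show i + 1 ≤ k by omega) hk.le
    linarith [ht.1]
  have e2 : ∑ i ∈ Finset.Ico (k + 1) n, (p (i + 1) - p i) * σ ((t - x i) / (x (i + 1) - x i))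
      = 0 := by
    refine Finset.sum_eq_zero fun i hi => ?_
    have hi := Finset.mem_Ico.1 hi
    rw [h0 _ (div_nonpos_of_nonpos_of_nonneg _ (hpos i hi.2).le), mul_zero]
    have := h.le hi.1 hi.2.le
    linarith [ht.2]
  unfold interp
  rw [Finset.range_eq_Ico, ← Finset.sum_Ico_consecutive _ (Nat.zero_le (k + 1)) (by omega : k + 1 ≤ n),
    e2, ← Finset.range_eq_Ico, Finset.sum_range_succ, e1, add_zero]

/-- With `s` the value of the profile, the interpolant is `(Z - s) * p k + s * p (k + 1)`:
nonnegative weights of total `Z ≤ 1`. -/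
theorem abs_interp_le (h : IsGrid a b n x) (hn : 0 < n) {p : ℕ → ℝ} (hp0 : p 0 = 0)
    (hp : ∀ i ≤ n, |p i| ≤ 1) (h0 : ∀ s ≤ 0, σ s = 0)
    (h1 : ∀ s, 1 ≤ s → σ s = Z) (hσ : ∀ s, 0 ≤ σ s ∧ σ s ≤ Z) (hZ : Z ≤ 1) {t : ℝ}
    (ht : t ∈ Icc a b) : |interp σ x p n t| ≤ 1 := by
  obtain ⟨k, hk, htk⟩ := h.exists_mem_Icc hn ht
  rw [interp_apply h p h0 h1 hk htk, hp0, sub_zero]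
  obtain ⟨s0, s1⟩ := hσ ((t - x k) / (x (k + 1) - x k))
  set s := σ ((t - x k) / (x (k + 1) - x k))
  have hk0 := abs_le.1 (hp k hk.le)
  have hk1 := abs_le.1 (hp (k + 1) hk)
  have e : Z * p k + (p (k + 1) - p k) * s = (Z - s) * p k + s * p (k + 1) := by ring
  rw [e, abs_le]
  constructor <;> nlinarith [mul_nonneg (sub_nonneg.2 s1) (sub_nonneg.2 hk0.2),
    mul_nonneg (sub_nonneg.2 s1) (sub_nonneg.2 hk0.1), mul_nonneg s0 (sub_nonneg.2 hk1.2),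
    mul_nonneg s0 (sub_nonneg.2 hk1.1)]

theorem interp_of_le (h : IsGrid a b n x) (p : ℕ → ℝ) (h0 : ∀ s ≤ 0, σ s = 0) {t : ℝ}
    (ht : t ≤ a) : interp σ x p n t = 0 := by
  refine Finset.sum_eq_zero fun i hi => ?_
  have hi := Finset.mem_range.1 hi
  have := h.left_le hi.le
  rw [h0 _ (div_nonpos_of_nonpos_of_nonneg (by linarith) (sub_pos.2 (h.lt_succ i hi)).le),
    mul_zero]

theorem interp_of_ge (h : IsGrid a b n x) (p : ℕ → ℝ) (h1 : ∀ s, 1 ≤ s → σ s = Z) {t : ℝ}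
    (ht : b ≤ t) : interp σ x p n t = Z * (p n - p 0) := by
  rw [← Finset.sum_range_sub p n, Finset.mul_sum]
  refine Finset.sum_congr rfl fun i hi => ?_
  have hi := Finset.mem_range.1 hi
  have := h.le_right (show i + 1 ≤ n from hi)
  rw [h1 _ ((one_le_div (sub_pos.2 (h.lt_succ i hi))).2 (by linarith)), mul_comm]

end Step

end ROF

/-! ### Distributional derivatives and the fundamental theorem of calculus -/

namespace ROF

section Derivative

variable {a b : ℝ}

theorem IsTestFunction.apply_left {φ : ℝ → ℝ} (h : IsTestFunction a b φ) : φ a = 0 :=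
  image_eq_zero_of_notMem_tsupport fun ha => lt_irrefl _ (h.2.2 ha).1

theorem IsTestFunction.apply_right {φ : ℝ → ℝ} (h : IsTestFunction a b φ) : φ b = 0 :=
  image_eq_zero_of_notMem_tsupport fun hb => lt_irrefl _ (h.2.2 hb).2

theorem IsTestFunction.continuous_deriv {φ : ℝ → ℝ} (h : IsTestFunction a b φ) :
    Continuous (deriv φ) := h.1.continuous_deriv le_rfl

theorem IsTestFunction.exists_abs_le {φ : ℝ → ℝ} (h : IsTestFunction a b φ) :
    ∃ C, ∀ t, ‖φ t‖ ≤ C := h.1.continuous.bounded_above_of_compact_support h.2.1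

theorem IsTestFunction.exists_abs_deriv_le {φ : ℝ → ℝ} (h : IsTestFunction a b φ) :
    ∃ C, ∀ t, ‖deriv φ t‖ ≤ C :=
  h.continuous_deriv.bounded_above_of_compact_support h.2.1.deriv

theorem IsTestFunction.integrableOn_mul_deriv {φ u : ℝ → ℝ} (h : IsTestFunction a b φ)
    (hu : IntegrableOn u (Ioo a b)) : IntegrableOn (fun t => u t * deriv φ t) (Ioo a b) := by
  obtain ⟨C, hC⟩ := h.exists_abs_deriv_le
  exact Integrable.mul_bdd hu h.continuous_deriv.aestronglyMeasurable
    (Filter.Eventually.of_forall hC)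

theorem IsTestFunction.integrableOn_mul {φ u : ℝ → ℝ} (h : IsTestFunction a b φ)
    (hu : IntegrableOn u (Ioo a b)) : IntegrableOn (fun t => u t * φ t) (Ioo a b) := by
  obtain ⟨C, hC⟩ := h.exists_abs_le
  exact Integrable.mul_bdd hu h.1.continuous.aestronglyMeasurable
    (Filter.Eventually.of_forall hC)

theorem setIntegral_Ioo_eq (hab : a ≤ b) (u : ℝ → ℝ) :
    ∫ t in Ioo a b, u t = ∫ t in a..b, u t := by
  rw [intervalIntegral.integral_of_le hab, integral_Ioc_eq_integral_Ioo]

theorem intervalIntegrable_of_Ioo (hab : a ≤ b) {u : ℝ → ℝ} (hu : IntegrableOn u (Ioo a b)) :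
    IntervalIntegrable u volume a b := by
  rw [intervalIntegrable_iff_integrableOn_Ioo_of_le hab]; exact hu

theorem IsTestFunction.integral_deriv {φ : ℝ → ℝ} (h : IsTestFunction a b φ) (s t : ℝ) :
    ∫ r in s..t, deriv φ r = φ t - φ s :=
  intervalIntegral.integral_deriv_eq_sub
    (fun _ _ => (h.1.differentiable one_ne_zero).differentiableAt)
    (h.continuous_deriv.intervalIntegrable _ _)

/-- A primitive of an integrable function has that function as its distributional derivative. -/
theorem hasDistribDeriv_primitive (hab : a ≤ b) {g : ℝ → ℝ} (hg : IntegrableOn g (Ioo a b)) :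
    HasDistribDeriv a b (fun t => ∫ s in a..t, g s) g := by
  intro φ hφ
  have hi := intervalIntegrable_of_Ioo hab hg
  have hG := hi.absolutelyContinuousOnInterval_intervalIntegral (c := a) (by simp)
  have hφ' : AbsolutelyContinuousOnInterval φ a b :=
    hφ.1.contDiffOn.absolutelyContinuousOnInterval
  rw [setIntegral_Ioo_eq hab, setIntegral_Ioo_eq hab,
    hG.integral_mul_deriv_eq_deriv_mul hφ', hφ.apply_left, hφ.apply_right, mul_zero, mul_zero,
    sub_zero, zero_sub]
  congr 1
  refine intervalIntegral.integral_congr_ae ?_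
  filter_upwards [hi.ae_hasDerivAt_integral] with t ht htm
  rw [(ht (uIoc_subset_uIcc htm) a (by simp)).deriv]

/-- The primitive of a continuous function with compact support and vanishing mean. -/
theorem isTestFunction_primitive {α β : ℝ} (ha : a < α) (hb : β < b) {k : ℝ → ℝ}
    (hk : Continuous k) (h0 : ∀ t ∉ Ioo α β, k t = 0) (hint : ∫ t in α..β, k t = 0) :
    IsTestFunction a b (fun t => ∫ s in α..t, k s) ∧
      deriv (fun t => ∫ s in α..t, k s) = k := by
  have hd : ∀ t, HasDerivAt (fun t => ∫ s in α..t, k s) (k t) t := fun t =>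
    intervalIntegral.integral_hasDerivAt_right (hk.intervalIntegrable _ _)
      (hk.stronglyMeasurableAtFilter _ _) hk.continuousAt
  have hde : deriv (fun t => ∫ s in α..t, k s) = k := funext fun t => (hd t).deriv
  have hsupp : Function.support (fun t => ∫ s in α..t, k s) ⊆ Icc α β := by
    intro t ht
    by_contra hc
    apply ht
    rcases lt_or_ge t α with h1 | h1
    · refine intervalIntegral.integral_zero_ae (Filter.Eventually.of_forall fun s hs => h0 s ?_)
      rw [uIoc_of_ge h1.le] at hs
      exact fun hm => hm.1.not_ge hs.2
    · have h2 : β < t := by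
        by_contra! h2
        exact hc ⟨h1, h2⟩
      show ∫ s in α..t, k s = 0
      rw [← intervalIntegral.integral_add_adjacent_intervals (hk.intervalIntegrable α β)
        (hk.intervalIntegrable β t), hint, zero_add]
      refine intervalIntegral.integral_zero_ae (Filter.Eventually.of_forall fun s hs => h0 s ?_)
      rw [uIoc_of_le h2.le] at hs
      exact fun hm => hm.2.not_gt hs.1
  refine ⟨⟨?_, HasCompactSupport.of_support_subset_isCompact isCompact_Icc hsupp, ?_⟩, hde⟩
  · rw [contDiff_one_iff_deriv, hde]
    exact ⟨fun t => (hd t).differentiableAt, hk⟩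
  · exact (closure_minimal hsupp isClosed_Icc).trans (Icc_subset_Ioo ha hb)

/-- The lemma of du Bois-Reymond, for continuous functions. -/
theorem eqOn_const_of_integral_mul_deriv_eq_zero (hab : a < b) {h : ℝ → ℝ}
    (hc : ContinuousOn h (Icc a b))
    (h0 : ∀ φ, IsTestFunction a b φ → ∫ t in Ioo a b, h t * deriv φ t = 0) :
    ∀ t ∈ Icc a b, h t = h a := by
  -- Take a bump `χ` that is positive exactly on `(α, β)`, and let `m` be the `χ`-weighted mean of
  -- `h`. Then `χ * (h - m)` has integral zero, so it is the derivative of a test function, and the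
  -- hypothesis yields `∫ χ * (h - m)² = 0`.
  have key : ∀ α β, a < α → α < β → β < b → ∃ m, ∀ t ∈ Ioo α β, h t = m := by
    intro α β ha hαβ hb
    -- The extension makes the integrands continuous on all of `ℝ`.
    let H : ℝ → ℝ := IccExtend hab.le ((Icc a b).domRestrict h)
    have hH : Continuous H := (continuousOn_iff_continuous_domRestrict.1 hc).Icc_extend'
    have hHh : ∀ t ∈ Icc a b, H t = h t := fun t ht => IccExtend_of_mem hab.le _ ht
    let χ : ℝ → ℝ := fun t => max 0 ((t - α) * (β - t))
    have hχ : Continuous χ := by fun_prop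
    have hχ0 : ∀ t, 0 ≤ χ t := fun t => le_max_left _ _
    have hχpos : ∀ t ∈ Ioo α β, 0 < χ t := fun t ht =>
      lt_max_of_lt_right (mul_pos (sub_pos.2 ht.1) (sub_pos.2 ht.2))
    have hχout : ∀ t ∉ Ioo α β, χ t = 0 := by
      intro t ht
      refine max_eq_left ?_
      rcases le_or_gt t α with h1 | h1
      · exact mul_nonpos_of_nonpos_of_nonneg (by linarith) (by linarith)
      · have h2 : β ≤ t := by
          by_contra! h2
          exact ht ⟨h1, h2⟩
        exact mul_nonpos_of_nonneg_of_nonpos (by linarith) (by linarith)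
    have hI : 0 < ∫ t in α..β, χ t :=
      intervalIntegral.integral_pos hαβ hχ.continuousOn (fun t _ => hχ0 t)
        ⟨(α + β) / 2, ⟨by linarith, by linarith⟩, hχpos _ ⟨by linarith, by linarith⟩⟩
    let m : ℝ := (∫ t in α..β, χ t * H t) / ∫ t in α..β, χ t
    let k : ℝ → ℝ := fun t => χ t * (H t - m)
    have hk : Continuous k := hχ.mul (hH.sub continuous_const)
    have hkout : ∀ t ∉ Ioo α β, k t = 0 := fun t ht => by simp [k, hχout t ht]
    have hkint : ∫ t in α..β, k t = 0 := by
      have e : ∀ t, k t = χ t * H t - m * χ t := fun t => by simp only [k]; ring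
      simp only [e]
      have c1 : Continuous fun t => χ t * H t := hχ.mul hH
      have c2 : Continuous fun t => m * χ t := continuous_const.mul hχ
      rw [intervalIntegral.integral_sub (c1.intervalIntegrable _ _)
        (c2.intervalIntegrable _ _), intervalIntegral.integral_const_mul,
        div_mul_cancel₀ _ hI.ne', sub_self]
    obtain ⟨hφ, hφ'⟩ := isTestFunction_primitive ha hb hk hkout hkint
    have h1 := h0 _ hφ
    rw [hφ'] at h1
    have h2 : ∫ t in α..β, H t * k t = 0 := by
      have e : ∫ t in Ioo a b, h t * k t = ∫ t in Ioo α β, h t * k t :=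
        setIntegral_eq_of_subset_of_forall_sdiff_eq_zero measurableSet_Ioo
          (Ioo_subset_Ioo ha.le hb.le) fun t ht => by simp [hkout t ht.2]
      rw [← h1, e, ← setIntegral_Ioo_eq hαβ.le]
      refine setIntegral_congr_fun measurableSet_Ioo fun t ht => ?_
      simp only [hHh t ⟨(ha.trans ht.1).le, (ht.2.trans hb).le⟩]
    have h3 : ∫ t in α..β, χ t * (H t - m) ^ 2 = 0 := by
      have e : ∀ t, χ t * (H t - m) ^ 2 = H t * k t - m * k t := fun t => by
        simp only [k]; ring
      simp only [e]
      have c1 : Continuous fun t => H t * k t := hH.mul hk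
      have c2 : Continuous fun t => m * k t := continuous_const.mul hk
      rw [intervalIntegral.integral_sub (c1.intervalIntegrable _ _)
        (c2.intervalIntegrable _ _), intervalIntegral.integral_const_mul,
        h2, hkint, mul_zero, sub_zero]
    refine ⟨m, fun t ht => ?_⟩
    by_contra hne
    rw [← hHh t ⟨(ha.trans ht.1).le, (ht.2.trans hb).le⟩] at hne
    refine (intervalIntegral.integral_pos hαβ
      (hχ.mul ((hH.sub continuous_const).pow 2)).continuousOn
      (fun s _ => mul_nonneg (hχ0 s) (sq_nonneg _)) ⟨t, Ioo_subset_Icc_self ht, ?_⟩).ne' h3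
    exact mul_pos (hχpos t ht) (sq_pos_of_ne_zero (sub_ne_zero.2 hne))
  have hmid : ∀ t ∈ Ioo a b, h t = h ((a + b) / 2) := by
    intro t ht
    obtain ⟨α, h1, h2⟩ := exists_between (lt_min ht.1 (show a < (a + b) / 2 by linarith))
    obtain ⟨β, h3, h4⟩ := exists_between (max_lt ht.2 (show (a + b) / 2 < b by linarith))
    have h2' := lt_min_iff.1 h2
    have h3' := max_lt_iff.1 h3
    obtain ⟨m, hm⟩ := key α β h1 (h2'.1.trans h3'.1) h4
    rw [hm t ⟨h2'.1, h3'.1⟩, hm _ ⟨h2'.2, h3'.2⟩]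
  have hall : EqOn h (fun _ => h ((a + b) / 2)) (Icc a b) :=
    EqOn.of_subset_closure hmid hc continuousOn_const Ioo_subset_Icc_self
      (closure_Ioo hab.ne).ge
  intro t ht
  rw [hall ht, hall (left_mem_Icc.2 hab.le)]

/-- The fundamental theorem of calculus for distributional derivatives. -/
theorem HasDistribDeriv.integral_eq_sub (hab : a < b) {η g : ℝ → ℝ}
    (h : HasDistribDeriv a b η g) (hη : ContinuousOn η (Icc a b))
    (hg : IntegrableOn g (Ioo a b)) {s t : ℝ} (hs : s ∈ Icc a b) (ht : t ∈ Icc a b) :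
    ∫ r in s..t, g r = η t - η s := by
  have hi := intervalIntegrable_of_Ioo hab.le hg
  have hG : ContinuousOn (fun t => ∫ s in a..t, g s) (Icc a b) := by
    have := (hi.absolutelyContinuousOnInterval_intervalIntegral (c := a) (by simp)).continuousOn
    rwa [uIcc_of_le hab.le] at this
  -- `η` and the primitive of `g` have the same distributional derivative, so their difference is
  -- constant.
  have key := eqOn_const_of_integral_mul_deriv_eq_zero hab (hη.sub hG) fun φ hφ => by
    have hη' : IntegrableOn η (Ioo a b) :=
      (hη.integrableOn_compact isCompact_Icc).mono_set Ioo_subset_Icc_self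
    have hG' : IntegrableOn (fun t => ∫ s in a..t, g s) (Ioo a b) :=
      (hG.integrableOn_compact isCompact_Icc).mono_set Ioo_subset_Icc_self
    simp only [Pi.sub_apply, sub_mul]
    rw [integral_sub (hφ.integrableOn_mul_deriv hη') (hφ.integrableOn_mul_deriv hG'), h φ hφ,
      hasDistribDeriv_primitive hab.le hg φ hφ, sub_self]
  have k1 := key t ht
  have k2 := key s hs
  simp only [Pi.sub_apply] at k1 k2
  have hsub : ∀ r ∈ Icc a b, IntervalIntegrable g volume a r := fun r hr =>
    hi.mono_set (by rw [uIcc_of_le hab.le, uIcc_of_le hr.1]; exact Icc_subset_Icc_right hr.2)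
  rw [← intervalIntegral.integral_interval_sub_left (hsub t ht) (hsub s hs)]
  linarith

/-- The fundamental lemma of the calculus of variations, applied to `g - g'` extended by zero
outside the interval. -/
theorem HasDistribDeriv.ae_unique {u g g' : ℝ → ℝ} (h : HasDistribDeriv a b u g)
    (h' : HasDistribDeriv a b u g') (hg : IntegrableOn g (Ioo a b))
    (hg' : IntegrableOn g' (Ioo a b)) : g =ᵐ[volume.restrict (Ioo a b)] g' := by
  have key := isOpen_Ioo.ae_eq_zero_of_integral_contDiff_smul_eq_zero
    (f := fun t => (Ioo a b).indicator (fun s => g s - g' s) t) (μ := volume) (U := Ioo a b)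
    (((integrable_indicator_iff measurableSet_Ioo).2
      (hg.sub hg')).locallyIntegrable.locallyIntegrableOn _) (by
    intro φ hφ hφc hφs
    have hφt : IsTestFunction a b φ := ⟨hφ.of_le (by exact_mod_cast le_top), hφc, hφs⟩
    have e : ∀ t, φ t • (Ioo a b).indicator (fun s => g s - g' s) t
        = (Ioo a b).indicator (fun s => g s * φ s - g' s * φ s) t := by
      intro t
      by_cases ht : t ∈ Ioo a b
      · simp [ht]; ring
      · simp [ht]
    simp only [e]
    rw [integral_indicator measurableSet_Ioo,
      integral_sub (hφt.integrableOn_mul hg) (hφt.integrableOn_mul hg')]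
    have := (h φ hφt).symm.trans (h' φ hφt)
    linarith)
  rw [Filter.EventuallyEq, ae_restrict_iff' measurableSet_Ioo]
  filter_upwards [key] with t ht hm
  have := ht hm
  rw [indicator_of_mem hm] at this
  linarith

theorem MemL2.integrableOn {u : ℝ → ℝ} (h : MemL2 a b u) : IntegrableOn u (Ioo a b) :=
  MemLp.integrable (by norm_num) h

theorem MemH1.distribDeriv_spec {u : ℝ → ℝ} (h : MemH1 a b u) :
    MemL2 a b (distribDeriv a b u) ∧ HasDistribDeriv a b u (distribDeriv a b u) := by
  have := h.2
  rw [distribDeriv, dif_pos this]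
  exact this.choose_spec

end Derivative

end ROF

/-! ### Smooth cut-offs and the total variation -/

namespace ROF

open Filter Topology

/-- A continuous approximation, supported away from the boundary, of the indicator function of the
unit interval. -/
noncomputable def cutoff (n : ℕ) (r : ℝ) : ℝ :=
  max 0 (min 1 ((n + 1) * min r (1 - r) - 1))

theorem continuous_cutoff (n : ℕ) : Continuous (cutoff n) := by
  unfold cutoff; fun_prop

theorem cutoff_nonneg (n : ℕ) (r : ℝ) : 0 ≤ cutoff n r := le_max_left _ _

theorem cutoff_le_one (n : ℕ) (r : ℝ) : cutoff n r ≤ 1 := max_le zero_le_one (min_le_left _ _)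

theorem cutoff_eq_zero {n : ℕ} {r : ℝ} (h : min r (1 - r) ≤ 1 / (n + 1)) : cutoff n r = 0 := by
  refine max_eq_left (min_le_of_right_le ?_)
  rw [le_div_iff₀ (by positivity)] at h
  linarith

theorem tendsto_cutoff (r : ℝ) :
    Tendsto (fun n => cutoff n r) atTop (𝓝 ((Ioo (0 : ℝ) 1).indicator (fun _ => 1) r)) := by
  by_cases hr : r ∈ Ioo (0 : ℝ) 1
  · rw [indicator_of_mem hr]
    have hpos : 0 < min r (1 - r) := lt_min hr.1 (by linarith [hr.2])
    -- The factor `2` compensates the `- 1` in `cutoff`, so that the inner minimum is attained by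
    -- `1`.
    obtain ⟨N, hN⟩ := exists_nat_gt (2 / min r (1 - r))
    refine tendsto_const_nhds.congr' ?_
    filter_upwards [eventually_ge_atTop N] with n hn
    have h1 : (2 : ℝ) ≤ (n + 1) * min r (1 - r) := by
      rw [div_lt_iff₀ hpos] at hN
      have : (N : ℝ) ≤ n + 1 := by exact_mod_cast hn.trans (Nat.le_succ n)
      nlinarith
    rw [cutoff, min_eq_left (by linarith), max_eq_right zero_le_one]
  · rw [indicator_of_notMem hr]
    refine tendsto_const_nhds.congr fun n => (cutoff_eq_zero ?_).symm
    have h0 : min r (1 - r) ≤ 0 := by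
      rcases le_or_gt r 0 with h | h
      · exact min_le_of_left_le h
      · have : 1 ≤ r := by
          by_contra! h1
          exact hr ⟨h, h1⟩
        exact min_le_of_right_le (by linarith)
    exact h0.trans (by positivity)

/-- The primitive of `cutoff n` that vanishes at `0`. -/
noncomputable def cutoffInt (n : ℕ) (s : ℝ) : ℝ := ∫ r in (0 : ℝ)..s, cutoff n r

theorem hasDerivAt_cutoffInt (n : ℕ) (s : ℝ) : HasDerivAt (cutoffInt n) (cutoff n s) s :=
  intervalIntegral.integral_hasDerivAt_right ((continuous_cutoff n).intervalIntegrable _ _)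
    ((continuous_cutoff n).stronglyMeasurableAtFilter _ _) (continuous_cutoff n).continuousAt

theorem monotone_cutoffInt (n : ℕ) : Monotone (cutoffInt n) :=
  monotone_of_hasDerivAt_nonneg (hasDerivAt_cutoffInt n) (cutoff_nonneg n)

/-- Flatness near both ends of the unit interval, here and in `cutoffInt_of_ge`, is what gives the
interpolants compact support inside `(a, b)`. -/
theorem cutoffInt_of_le {n : ℕ} {s : ℝ} (hs : s ≤ 1 / (n + 1)) : cutoffInt n s = 0 := by
  refine intervalIntegral.integral_zero_ae (Eventually.of_forall fun r hr => cutoff_eq_zero ?_)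
  refine min_le_of_left_le ?_
  rcases le_total 0 s with h | h
  · rw [uIoc_of_le h] at hr
    exact hr.2.trans hs
  · rw [uIoc_of_ge h] at hr
    exact hr.2.trans (by positivity)

theorem cutoffInt_of_ge {n : ℕ} {s : ℝ} (hs : 1 - 1 / (n + 1) ≤ s) :
    cutoffInt n s = cutoffInt n 1 := by
  have hi : ∀ u v, IntervalIntegrable (cutoff n) volume u v :=
    (continuous_cutoff n).intervalIntegrable
  have : ∫ r in s..1, cutoff n r = 0 := by
    refine intervalIntegral.integral_zero_ae (Eventually.of_forall fun r hr => cutoff_eq_zero ?_)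
    refine min_le_of_right_le ?_
    rcases le_total s 1 with h | h
    · rw [uIoc_of_le h] at hr
      linarith [hr.1]
    · rw [uIoc_of_ge h] at hr
      exact (by linarith [hr.1] : 1 - r ≤ 0).trans (by positivity)
  rw [cutoffInt, cutoffInt, ← intervalIntegral.integral_add_adjacent_intervals (hi 0 s) (hi s 1),
    this, add_zero]

theorem cutoffInt_nonneg (n : ℕ) (s : ℝ) : 0 ≤ cutoffInt n s := by
  rcases le_total s 0 with h | h
  · exact (cutoffInt_of_le (h.trans (by positivity))).ge
  · exact intervalIntegral.integral_nonneg h fun r _ => cutoff_nonneg n r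

theorem cutoffInt_le (n : ℕ) (s : ℝ) : cutoffInt n s ≤ cutoffInt n 1 := by
  rcases le_total s 1 with h | h
  · exact monotone_cutoffInt n h
  · exact (cutoffInt_of_ge (le_trans (sub_le_self _ (by positivity)) h)).le

theorem cutoffInt_one_le (n : ℕ) : cutoffInt n 1 ≤ 1 := by
  have := intervalIntegral.integral_mono_on (μ := volume) (zero_le_one' ℝ)
    ((continuous_cutoff n).intervalIntegrable 0 1) (continuous_const.intervalIntegrable 0 1)
    (fun r _ => cutoff_le_one n r)
  simpa [cutoffInt] using this

section TotalVariation

variable {a b : ℝ} {m : ℕ} {x : ℕ → ℝ}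

theorem hasDerivAt_interp_cutoffInt (x p : ℕ → ℝ) (m n : ℕ) (t : ℝ) :
    HasDerivAt (interp (cutoffInt n) x p m)
      (∑ i ∈ Finset.range m, (p (i + 1) - p i) / (x (i + 1) - x i)
        * cutoff n ((t - x i) / (x (i + 1) - x i))) t := by
  unfold interp
  refine HasDerivAt.fun_sum fun i _ => ?_
  have h1 : HasDerivAt (fun t => (t - x i) / (x (i + 1) - x i)) (1 / (x (i + 1) - x i)) t :=
    ((hasDerivAt_id t).sub_const _).div_const _
  exact (((hasDerivAt_cutoffInt n _).comp t h1).const_mul (p (i + 1) - p i)).congr_deriv (by ring)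

/-- As the end values are zero and the profile is flat near its ends, the interpolant vanishes on
the first `1 / (n + 1)` of the first interval and on the last `1 / (n + 1)` of the last one. -/
theorem isTestFunction_interp (h : IsGrid a b (m + 1) x) {p : ℕ → ℝ} (hp0 : p 0 = 0)
    (hpm : p (m + 1) = 0) (n : ℕ) : IsTestFunction a b (interp (cutoffInt n) x p (m + 1)) := by
  have hd := hasDerivAt_interp_cutoffInt x p (m + 1) n
  have h0 : ∀ s ≤ 0, cutoffInt n s = 0 := fun s hs => cutoffInt_of_le (hs.trans (by positivity))
  have h1 : ∀ s, 1 ≤ s → cutoffInt n s = cutoffInt n 1 := fun s hs =>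
    cutoffInt_of_ge (le_trans (sub_le_self _ (by positivity)) hs)
  have hl := sub_pos.2 (h.lt_succ 0 (by omega))
  have hr := sub_pos.2 (h.lt_succ m (by omega))
  have hδ : (0 : ℝ) < 1 / (n + 1) := by positivity
  have hsupp : Function.support (interp (cutoffInt n) x p (m + 1)) ⊆
      Icc (a + 1 / (n + 1) * (x (0 + 1) - x 0)) (b - 1 / (n + 1) * (x (m + 1) - x m)) := by
    intro t ht
    by_contra hc
    apply ht
    rcases le_or_gt t a with ha | ha
    · exact interp_of_le h p h0 ha
    rcases le_or_gt b t with hb | hb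
    · rw [interp_of_ge h p h1 hb, hp0, hpm, sub_zero, mul_zero]
    by_cases hx1 : t < a + 1 / (n + 1) * (x (0 + 1) - x 0)
    · have hle : t ≤ x (0 + 1) ∨ x (0 + 1) < t := le_or_gt _ _
      have hlen : 1 / ((n : ℝ) + 1) * (x (0 + 1) - x 0) ≤ x (0 + 1) - x 0 := by
        refine mul_le_of_le_one_left hl.le ?_
        rw [div_le_one (by positivity)]; linarith [Nat.cast_nonneg (α := ℝ) n]
      rw [interp_apply h p h0 h1 (k := 0) (by omega)
        ⟨by rw [h.left]; exact ha.le, by linarith [h.left]⟩, sub_self, mul_zero,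
        cutoffInt_of_le, mul_zero, add_zero]
      rw [div_le_iff₀ hl]; linarith [h.left]
    · have hx2 : b - 1 / (n + 1) * (x (m + 1) - x m) < t := by
        by_contra! hx2
        exact hc ⟨not_lt.1 hx1, hx2⟩
      have hlen : 1 / ((n : ℝ) + 1) * (x (m + 1) - x m) ≤ x (m + 1) - x m := by
        refine mul_le_of_le_one_left hr.le ?_
        rw [div_le_one (by positivity)]; linarith [Nat.cast_nonneg (α := ℝ) n]
      rw [interp_apply h p h0 h1 (k := m) (by omega)
        ⟨by linarith [h.right], by rw [h.right]; exact hb.le⟩, hp0, hpm,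
        cutoffInt_of_ge (s := (t - x m) / (x (m + 1) - x m))]
      · ring
      · rw [le_div_iff₀ hr]; linarith [h.right]
  refine ⟨?_, HasCompactSupport.of_support_subset_isCompact isCompact_Icc hsupp, ?_⟩
  · rw [contDiff_one_iff_deriv, funext fun t => (hd t).deriv]
    refine ⟨fun t => (hd t).differentiableAt, ?_⟩
    have := continuous_cutoff n
    fun_prop
  · exact (closure_minimal hsupp isClosed_Icc).trans
      (Icc_subset_Ioo (by linarith [mul_pos hδ hl]) (by linarith [mul_pos hδ hr]))

/-- Convergence holds even at the nodes, where the cut-offs vanish and `step`, built from open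
intervals, is zero. -/
theorem tendsto_deriv_interp (h : IsGrid a b m x) (p : ℕ → ℝ) (t : ℝ) :
    Tendsto (fun n => deriv (interp (cutoffInt n) x p m) t) atTop
      (𝓝 (step x (fun i => (p (i + 1) - p i) / (x (i + 1) - x i)) m t)) := by
  simp only [(hasDerivAt_interp_cutoffInt x p m _ t).deriv]
  refine tendsto_finsetSum _ fun i hi => ?_
  have hl := sub_pos.2 (h.lt_succ i (Finset.mem_range.1 hi))
  convert (tendsto_cutoff ((t - x i) / (x (i + 1) - x i))).const_mul
    ((p (i + 1) - p i) / (x (i + 1) - x i)) using 2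
  have e : t ∈ Ioo (x i) (x (i + 1)) ↔ (t - x i) / (x (i + 1) - x i) ∈ Ioo (0 : ℝ) 1 := by
    rw [mem_Ioo, mem_Ioo, div_pos_iff_of_pos_right hl, sub_pos, div_lt_one hl,
      sub_lt_sub_iff_right]
  by_cases ht : t ∈ Ioo (x i) (x (i + 1))
  · rw [indicator_of_mem ht, indicator_of_mem (e.1 ht), mul_one]
  · rw [indicator_of_notMem ht, indicator_of_notMem (fun h => ht (e.2 h)), mul_zero]

theorem abs_deriv_interp_le (x p : ℕ → ℝ) (m n : ℕ) (t : ℝ) :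
    |deriv (interp (cutoffInt n) x p m) t|
      ≤ ∑ i ∈ Finset.range m, |(p (i + 1) - p i) / (x (i + 1) - x i)| := by
  rw [(hasDerivAt_interp_cutoffInt x p m n t).deriv]
  refine (Finset.abs_sum_le_sum_abs _ _).trans (Finset.sum_le_sum fun i _ => ?_)
  rw [abs_mul, abs_of_nonneg (cutoff_nonneg _ _)]
  exact mul_le_of_le_one_right (abs_nonneg _) (cutoff_le_one _ _)

/-- Piecewise linear functions are admissible in the definition of the total variation. -/
theorem ofReal_integral_mul_step_le (h : IsGrid a b (m + 1) x) {p : ℕ → ℝ} (hp0 : p 0 = 0)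
    (hpm : p (m + 1) = 0) (hp : ∀ i ≤ m + 1, |p i| ≤ 1) {v : ℝ → ℝ}
    (hv : IntegrableOn v (Ioo a b)) :
    ENNReal.ofReal (∫ t in Ioo a b,
      v t * step x (fun i => (p (i + 1) - p i) / (x (i + 1) - x i)) (m + 1) t)
      ≤ totalVariation a b v := by
  have hφ := isTestFunction_interp h hp0 hpm
  have hlim : Tendsto (fun n => ∫ t in Ioo a b,
      v t * deriv (interp (cutoffInt n) x p (m + 1)) t) atTop (𝓝 (∫ t in Ioo a b,
      v t * step x (fun i => (p (i + 1) - p i) / (x (i + 1) - x i)) (m + 1) t)) := by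
    -- The derivatives are bounded by the sum of the absolute slopes, uniformly in `n`, so mere
    -- integrability of `v` suffices.
    refine tendsto_integral_of_dominated_convergence
      (fun t => |v t| * ∑ i ∈ Finset.range (m + 1), |(p (i + 1) - p i) / (x (i + 1) - x i)|)
      (fun n => ((hφ n).integrableOn_mul_deriv hv).aestronglyMeasurable)
      (hv.abs.mul_const _) (fun n => Eventually.of_forall fun t => ?_)
      (Eventually.of_forall fun t => (tendsto_deriv_interp h p t).const_mul _)
    rw [Real.norm_eq_abs, abs_mul]
    exact mul_le_mul_of_nonneg_left (abs_deriv_interp_le x p _ n t) (abs_nonneg _)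
  refine le_of_tendsto (ENNReal.tendsto_ofReal hlim) (Eventually.of_forall fun n => ?_)
  refine le_iSup₂_of_le (interp (cutoffInt n) x p (m + 1)) ⟨hφ n, fun t => ?_⟩ le_rfl
  have h0 : ∀ s ≤ 0, cutoffInt n s = 0 := fun s hs => cutoffInt_of_le (hs.trans (by positivity))
  have h1 : ∀ s, 1 ≤ s → cutoffInt n s = cutoffInt n 1 := fun s hs =>
    cutoffInt_of_ge (le_trans (sub_le_self _ (by positivity)) hs)
  by_cases ht : t ∈ Icc a b
  · exact abs_interp_le h m.succ_pos hp0 hp h0 h1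
      (fun s => ⟨cutoffInt_nonneg n s, cutoffInt_le n s⟩) (cutoffInt_one_le n) ht
  · have : interp (cutoffInt n) x p (m + 1) t = 0 :=
      image_eq_zero_of_notMem_tsupport fun hm => ht (Ioo_subset_Icc_self ((hφ n).2.2 hm))
    rw [this, abs_zero]; exact zero_le_one

/-- Minus the signs of the jumps of the sequence `c` at the interior nodes, and zero at the ends. -/
noncomputable def jumpSign (c : ℕ → ℝ) (m i : ℕ) : ℝ :=
  if i = 0 ∨ i = m + 1 then 0 else -(SignType.sign (c i - c (i - 1)) : ℝ)

theorem jumpSign_zero (c : ℕ → ℝ) (m : ℕ) : jumpSign c m 0 = 0 := if_pos (Or.inl rfl)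

theorem jumpSign_last (c : ℕ → ℝ) (m : ℕ) : jumpSign c m (m + 1) = 0 := if_pos (Or.inr rfl)

theorem jumpSign_succ (c : ℕ → ℝ) {m i : ℕ} (hi : i < m) :
    jumpSign c m (i + 1) = -(SignType.sign (c (i + 1) - c i) : ℝ) := by
  rw [jumpSign, if_neg (by omega), Nat.add_sub_cancel]

theorem abs_jumpSign_le (c : ℕ → ℝ) (m i : ℕ) : |jumpSign c m i| ≤ 1 := by
  unfold jumpSign
  split_ifs
  · simp
  · rw [abs_neg]
    rcases SignType.sign (c i - c (i - 1)) with _ | _ | _ <;> simp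

/-- The minus in `jumpSign` cancels the one from summation by parts, and each jump times its sign is
its absolute value. -/
theorem sum_mul_jumpSign_sub (c : ℕ → ℝ) (m : ℕ) :
    ∑ i ∈ Finset.range (m + 1), c i * (jumpSign c m (i + 1) - jumpSign c m i)
      = ∑ i ∈ Finset.range m, |c (i + 1) - c i| := by
  rw [sum_mul_sub_eq, jumpSign_zero, jumpSign_last, mul_zero, mul_zero, sub_zero, zero_sub,
    ← Finset.sum_neg_distrib]
  refine Finset.sum_congr rfl fun i hi => ?_
  rw [jumpSign_succ c (Finset.mem_range.1 hi), mul_neg, neg_neg, self_mul_sign]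

/-- The mean value of `v` over `(x i, x (i + 1))`. -/
noncomputable def mean (x : ℕ → ℝ) (v : ℝ → ℝ) (i : ℕ) : ℝ :=
  (∫ t in (x i)..(x (i + 1)), v t) / (x (i + 1) - x i)

/-- Test `v` against the piecewise linear function with node values `jumpSign (mean x v) m`: its
derivative is constant on each interval and so sees only the means of `v`. -/
theorem ofReal_sum_abs_mean_le (h : IsGrid a b (m + 1) x) {v : ℝ → ℝ}
    (hv : IntegrableOn v (Ioo a b)) :
    ENNReal.ofReal (∑ i ∈ Finset.range m, |mean x v (i + 1) - mean x v i|)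
      ≤ totalVariation a b v := by
  refine le_of_eq_of_le (congrArg _ ?_) (ofReal_integral_mul_step_le h
    (jumpSign_zero (mean x v) m) (jumpSign_last (mean x v) m)
    (fun i _ => abs_jumpSign_le (mean x v) m i) hv)
  simp only [mul_comm (v _)]
  rw [integral_step_mul h _ hv, ← sum_mul_jumpSign_sub]
  refine Finset.sum_congr rfl fun i _ => ?_
  rw [mean]; ring

/-- Integrating `φ'` over each interval leaves the node values of `φ`; after summation by parts each
jump is weighted by a number of modulus at most one. -/
theorem totalVariation_step_le (h : IsGrid a b (m + 1) x) (c : ℕ → ℝ) :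
    totalVariation a b (step x c (m + 1))
      ≤ ENNReal.ofReal (∑ i ∈ Finset.range m, |c (i + 1) - c i|) := by
  refine iSup₂_le fun φ hφ => ENNReal.ofReal_le_ofReal ?_
  have hφi : IntegrableOn (deriv φ) (Ioo a b) :=
    (hφ.1.continuous_deriv.integrable_of_hasCompactSupport hφ.1.2.1.deriv).integrableOn
  rw [integral_step_mul h c hφi]
  simp only [hφ.1.integral_deriv]
  rw [sum_mul_sub_eq c (fun i => φ (x i)), h.left, h.right, hφ.1.apply_left, hφ.1.apply_right,
    mul_zero, mul_zero, sub_zero, zero_sub, ← Finset.sum_neg_distrib]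
  refine Finset.sum_le_sum fun i _ => ?_
  refine (neg_le_abs _).trans ?_
  rw [abs_mul]
  exact mul_le_of_le_one_right (abs_nonneg _) (hφ.2 _)

end TotalVariation

end ROF

/-! ### The finite-dimensional problem -/

namespace ROF

section Discrete

variable {a b lam : ℝ} {m : ℕ} {x : ℕ → ℝ}

/-- The Rudin-Osher-Fatemi functional for step functions on a common grid. -/
noncomputable def discreteEnergy (x d : ℕ → ℝ) (lam : ℝ) (m : ℕ) (c : ℕ → ℝ) : ℝ :=
  lam * ∑ i ∈ Finset.range m, |c (i + 1) - c i|
    + 1 / 2 * ∑ i ∈ Finset.range (m + 1), (x (i + 1) - x i) * (d i - c i) ^ 2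

theorem continuous_discreteEnergy (x d : ℕ → ℝ) (lam : ℝ) (m : ℕ) :
    Continuous (discreteEnergy x d lam m) := by
  unfold discreteEnergy; fun_prop

theorem abs_clamp_sub_clamp_le (R s t : ℝ) :
    |max (-R) (min R s) - max (-R) (min R t)| ≤ |s - t| := by
  refine (abs_max_sub_max_le_max _ _ _ _).trans ?_
  rw [sub_self, abs_zero, max_eq_right (abs_nonneg _)]
  refine (abs_min_sub_min_le_max _ _ _ _).trans ?_
  rw [sub_self, abs_zero, max_eq_right (abs_nonneg _)]

/-- Clamping to `[-R, R]` is 1-Lipschitz and fixes every `d i` that occurs, so it raises neither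
term of the energy; a minimizer over the compact product of these intervals is therefore a global
one. -/
theorem exists_forall_discreteEnergy_le (h : IsGrid a b (m + 1) x) (d : ℕ → ℝ) (hlam : 0 ≤ lam) :
    ∃ c, ∀ c', discreteEnergy x d lam m c ≤ discreteEnergy x d lam m c' := by
  let R : ℝ := ∑ i ∈ Finset.range (m + 1), |d i|
  have hR : 0 ≤ R := Finset.sum_nonneg fun _ _ => abs_nonneg _
  have hcomp : IsCompact (univ.pi fun _ : ℕ => Icc (-R) R) :=
    isCompact_univ_pi fun _ => isCompact_Icc
  obtain ⟨c, -, hc⟩ := hcomp.exists_isMinOn ⟨fun _ => 0, fun _ _ => ⟨by simpa using hR, hR⟩⟩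
    (continuous_discreteEnergy x d lam m).continuousOn
  refine ⟨c, fun c' => ?_⟩
  let e : ℕ → ℝ := fun i => max (-R) (min R (c' i))
  have he : e ∈ univ.pi fun _ : ℕ => Icc (-R) R := fun i _ =>
    ⟨le_max_left _ _, max_le (by linarith) (min_le_left _ _)⟩
  refine (hc he).trans ?_
  refine add_le_add (mul_le_mul_of_nonneg_left (Finset.sum_le_sum fun i _ =>
    abs_clamp_sub_clamp_le R _ _) hlam) (mul_le_mul_of_nonneg_left
    (Finset.sum_le_sum fun i hi => mul_le_mul_of_nonneg_left ?_
      (sub_pos.2 (h.lt_succ i (Finset.mem_range.1 hi))).le) (by norm_num))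
  have hd : |d i| ≤ R := Finset.single_le_sum (f := fun i => |d i|) (fun _ _ => abs_nonneg _) hi
  have hd' := abs_le.1 hd
  rw [sq_le_sq]
  have := abs_clamp_sub_clamp_le R (d i) (c' i)
  rwa [min_eq_right hd'.2, max_eq_right hd'.1] at this

/-- Quantitative strict convexity: the triangle inequality for the jumps and the parallelogram
identity for the squares. -/
theorem discreteEnergy_midpoint_le (x d : ℕ → ℝ) (hlam : 0 ≤ lam) (m : ℕ) (c c' : ℕ → ℝ) :
    discreteEnergy x d lam m (fun i => (c i + c' i) / 2)
        + 1 / 8 * ∑ i ∈ Finset.range (m + 1), (x (i + 1) - x i) * (c i - c' i) ^ 2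
      ≤ (discreteEnergy x d lam m c + discreteEnergy x d lam m c') / 2 := by
  have h1 : ∑ i ∈ Finset.range m, |(c (i + 1) + c' (i + 1)) / 2 - (c i + c' i) / 2|
      ≤ (∑ i ∈ Finset.range m, |c (i + 1) - c i|
        + ∑ i ∈ Finset.range m, |c' (i + 1) - c' i|) / 2 := by
    rw [← Finset.sum_add_distrib, Finset.sum_div]
    refine Finset.sum_le_sum fun i _ => ?_
    have e : (c (i + 1) + c' (i + 1)) / 2 - (c i + c' i) / 2
        = ((c (i + 1) - c i) + (c' (i + 1) - c' i)) / 2 := by ring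
    rw [e, abs_div, abs_two]
    exact div_le_div_of_nonneg_right (abs_add_le _ _) zero_le_two
  have h2 : ∑ i ∈ Finset.range (m + 1), (x (i + 1) - x i) * (d i - (c i + c' i) / 2) ^ 2
      = 1 / 2 * ∑ i ∈ Finset.range (m + 1), (x (i + 1) - x i) * (d i - c i) ^ 2
        + 1 / 2 * ∑ i ∈ Finset.range (m + 1), (x (i + 1) - x i) * (d i - c' i) ^ 2
        - 1 / 4 * ∑ i ∈ Finset.range (m + 1), (x (i + 1) - x i) * (c i - c' i) ^ 2 := by
    rw [Finset.mul_sum, Finset.mul_sum, Finset.mul_sum, ← Finset.sum_add_distrib,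
      ← Finset.sum_sub_distrib]
    exact Finset.sum_congr rfl fun i _ => by ring
  simp only [discreteEnergy, h2]
  linarith [mul_le_mul_of_nonneg_left h1 hlam]

/-- Otherwise the midpoint would have strictly smaller energy. -/
theorem eq_of_discreteEnergy_le (h : IsGrid a b (m + 1) x) (d : ℕ → ℝ) (hlam : 0 ≤ lam)
    {c c' : ℕ → ℝ} (hc : ∀ e, discreteEnergy x d lam m c ≤ discreteEnergy x d lam m e)
    (hc' : discreteEnergy x d lam m c' ≤ discreteEnergy x d lam m c) {i : ℕ} (hi : i < m + 1) :
    c' i = c i := by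
  have h1 := discreteEnergy_midpoint_le x d hlam m c c'
  have h2 := hc fun i => (c i + c' i) / 2
  have hnn : ∀ i ∈ Finset.range (m + 1), 0 ≤ (x (i + 1) - x i) * (c i - c' i) ^ 2 :=
    fun i hi => mul_nonneg (sub_pos.2 (h.lt_succ i (Finset.mem_range.1 hi))).le (sq_nonneg _)
  have h3 : ∑ i ∈ Finset.range (m + 1), (x (i + 1) - x i) * (c i - c' i) ^ 2 = 0 :=
    le_antisymm (by linarith) (Finset.sum_nonneg hnn)
  have h4 := (Finset.sum_eq_zero_iff_of_nonneg hnn).1 h3 i (Finset.mem_range.2 hi)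
  have h5 := (mul_eq_zero.1 h4).resolve_left (sub_pos.2 (h.lt_succ i hi)).ne'
  exact (sub_eq_zero.1 (pow_eq_zero_iff two_ne_zero |>.1 h5)).symm

theorem discreteEnergy_nonneg (h : IsGrid a b (m + 1) x) (d : ℕ → ℝ) (hlam : 0 ≤ lam)
    (c : ℕ → ℝ) : 0 ≤ discreteEnergy x d lam m c :=
  add_nonneg (mul_nonneg hlam (Finset.sum_nonneg fun _ _ => abs_nonneg _))
    (mul_nonneg (by norm_num) (Finset.sum_nonneg fun i hi =>
      mul_nonneg (sub_pos.2 (h.lt_succ i (Finset.mem_range.1 hi))).le (sq_nonneg _)))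

end Discrete

/-! ### Reduction of the primal problem to step functions -/

section Step

variable {a b lam : ℝ} {n m : ℕ} {x : ℕ → ℝ}

theorem step_sub_step (x c c' : ℕ → ℝ) (n : ℕ) (t : ℝ) :
    step x c n t - step x c' n t = step x (fun i => c i - c' i) n t := by
  simp only [step, ← Finset.sum_sub_distrib]
  refine Finset.sum_congr rfl fun i _ => ?_
  by_cases ht : t ∈ Ioo (x i) (x (i + 1)) <;> simp [ht]

theorem step_congr {c c' : ℕ → ℝ} (h : ∀ i < n, c i = c' i) : step x c n = step x c' n := by
  ext t
  exact Finset.sum_congr rfl fun i hi => by rw [h i (Finset.mem_range.1 hi)]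

theorem integral_step (h : IsGrid a b n x) (c : ℕ → ℝ) {k : ℕ} (hk : k < n) :
    ∫ t in (x k)..(x (k + 1)), step x c n t = c k * (x (k + 1) - x k) := by
  have hle := (h.lt_succ k hk).le
  rw [← setIntegral_Ioo_eq hle, setIntegral_congr_fun measurableSet_Ioo
    (fun t ht => step_apply h c hk ht), setIntegral_const]
  simp [hle, mul_comm]

theorem integral_step_sq (h : IsGrid a b n x) (c : ℕ → ℝ) :
    ∫ t in Ioo a b, step x c n t ^ 2
      = ∑ i ∈ Finset.range n, (x (i + 1) - x i) * c i ^ 2 := by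
  simp only [pow_two (step x c n _)]
  rw [integral_step_mul h c (integrableOn_step a b x c n)]
  refine Finset.sum_congr rfl fun i hi => ?_
  rw [integral_step h c (Finset.mem_range.1 hi)]; ring

theorem ofReal_energy_eq {A B : ℝ} (hlam : 0 ≤ lam) (hA : 0 ≤ A) (hB : 0 ≤ B) :
    ENNReal.ofReal (lam * A + 1 / 2 * B)
      = ENNReal.ofReal lam * ENNReal.ofReal A + 2⁻¹ * ENNReal.ofReal B := by
  rw [ENNReal.ofReal_add (mul_nonneg hlam hA) (by positivity), ENNReal.ofReal_mul hlam,
    ENNReal.ofReal_mul (by norm_num), one_div, ENNReal.ofReal_inv_of_pos two_pos,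
    ENNReal.ofReal_ofNat]

theorem energy_step_le (h : IsGrid a b (m + 1) x) {d : ℕ → ℝ} {f : ℝ → ℝ}
    (hf : f =ᵐ[volume.restrict (Ioo a b)] step x d (m + 1)) (hlam : 0 ≤ lam) (c : ℕ → ℝ) :
    energy a b f lam (step x c (m + 1)) ≤ ENNReal.ofReal (discreteEnergy x d lam m c) := by
  rw [discreteEnergy, ← integral_step_sq h (fun i => d i - c i),
    ofReal_energy_eq hlam (Finset.sum_nonneg fun _ _ => abs_nonneg _)
      (integral_nonneg fun _ => sq_nonneg _), energy]
  refine add_le_add (mul_le_mul_right (totalVariation_step_le h c) _)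
    (mul_le_mul_right (le_of_eq ?_) _)
  rw [ofReal_integral_eq_lintegral_ofReal (memLp_step a b x _ _ 2).integrable_sq
    (Filter.Eventually.of_forall fun _ => sq_nonneg _)]
  refine lintegral_congr_ae ?_
  filter_upwards [hf] with t ht
  rw [ht, step_sub_step]

theorem integral_mean_step_sub (h : IsGrid a b n x) {v : ℝ → ℝ}
    (hv : IntegrableOn v (Ioo a b)) {k : ℕ} (hk : k < n) :
    ∫ t in (x k)..(x (k + 1)), (step x (mean x v) n t - v t) = 0 := by
  have hl := h.lt_succ k hk
  rw [intervalIntegral.integral_sub, integral_step h _ hk, mean,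
    div_mul_cancel₀ _ (sub_pos.2 hl).ne', sub_self]
  · exact intervalIntegrable_of_Ioo hl.le (integrableOn_step _ _ x _ n)
  · exact intervalIntegrable_of_Ioo hl.le (hv.mono_set (h.Ioo_subset hk))

/-- Passing to the mean values over the intervals of the grid decreases the energy. -/
theorem ofReal_discreteEnergy_mean_le (h : IsGrid a b (m + 1) x) {d : ℕ → ℝ} {f : ℝ → ℝ}
    (hf : f =ᵐ[volume.restrict (Ioo a b)] step x d (m + 1)) (hlam : 0 ≤ lam) {v : ℝ → ℝ}
    (hv : IntegrableOn v (Ioo a b)) (hE : energy a b f lam v ≠ ⊤) :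
    MemL2 a b v ∧ ENNReal.ofReal (discreteEnergy x d lam m (mean x v)
      + 1 / 2 * ∫ t in Ioo a b, (step x (mean x v) (m + 1) t - v t) ^ 2)
      ≤ energy a b f lam v := by
  set α := mean x v
  -- A function in `BV` is only assumed integrable; its square integrability comes from the finite
  -- fidelity term.
  have hfin : ∫⁻ t in Ioo a b, ENNReal.ofReal ((f t - v t) ^ 2) ≠ ⊤ := by
    intro htop
    apply hE
    rw [energy, htop, ENNReal.mul_top (by simp), add_top]
  have hlint : ∫⁻ t in Ioo a b, ENNReal.ofReal ((f t - v t) ^ 2)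
      = ∫⁻ t in Ioo a b, ENNReal.ofReal ((step x d (m + 1) t - v t) ^ 2) := by
    refine lintegral_congr_ae ?_
    filter_upwards [hf] with t ht
    rw [ht]
  rw [hlint] at hfin
  have hmeas : AEStronglyMeasurable (fun t => step x d (m + 1) t - v t)
      (volume.restrict (Ioo a b)) :=
    ((integrableOn_step a b x d (m + 1)).sub hv).aestronglyMeasurable
  have hsq : Integrable (fun t => (step x d (m + 1) t - v t) ^ 2) (volume.restrict (Ioo a b)) :=
    ⟨hmeas.pow 2, (hasFiniteIntegral_iff_ofReal
      (Filter.Eventually.of_forall fun _ => sq_nonneg _)).2 hfin.lt_top⟩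
  have hL2 := (memLp_two_iff_integrable_sq hmeas).2 hsq
  have hv2 : MemL2 a b v := by
    have := (memLp_step a b x d (m + 1) 2).sub hL2
    refine this.ae_eq (Filter.Eventually.of_forall fun t => ?_)
    simp
  have hw : MemLp (fun t => step x α (m + 1) t - v t) 2 (volume.restrict (Ioo a b)) :=
    (memLp_step a b x α (m + 1) 2).sub hv2
  have hwi : IntegrableOn (fun t => step x α (m + 1) t - v t) (Ioo a b) :=
    (integrableOn_step a b x α (m + 1)).sub hv
  -- Averaging is the orthogonal projection onto step functions: `v` minus its means integrates to
  -- zero on each interval.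
  have horth : ∫ t in Ioo a b, step x (fun i => d i - α i) (m + 1) t
      * (step x α (m + 1) t - v t) = 0 := by
    rw [integral_step_mul h _ hwi]
    refine Finset.sum_eq_zero fun i hi => ?_
    rw [integral_mean_step_sub h hv (Finset.mem_range.1 hi), mul_zero]
  have hsplit : ∫ t in Ioo a b, (step x d (m + 1) t - v t) ^ 2
      = (∑ i ∈ Finset.range (m + 1), (x (i + 1) - x i) * (d i - α i) ^ 2)
        + ∫ t in Ioo a b, (step x α (m + 1) t - v t) ^ 2 := by
    have e : ∀ t, (step x d (m + 1) t - v t) ^ 2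
        = step x (fun i => d i - α i) (m + 1) t ^ 2
          + 2 * (step x (fun i => d i - α i) (m + 1) t * (step x α (m + 1) t - v t))
          + (step x α (m + 1) t - v t) ^ 2 := fun t => by
      rw [← step_sub_step]; ring
    have i1 := (memLp_step a b x (fun i => d i - α i) (m + 1) 2).integrable_sq
    have i2 := (integrableOn_step_mul (x := x) (n := m + 1) (fun i => d i - α i) hwi).const_mul 2
    have i12 : Integrable (fun t => step x (fun i => d i - α i) (m + 1) t ^ 2
        + 2 * (step x (fun i => d i - α i) (m + 1) t * (step x α (m + 1) t - v t)))
        (volume.restrict (Ioo a b)) := i1.add i2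
    simp only [e]
    rw [integral_add i12 hw.integrable_sq, integral_add i1 i2, integral_const_mul, horth,
      mul_zero, add_zero, integral_step_sq h]
  refine ⟨hv2, ?_⟩
  have hsum : discreteEnergy x d lam m α
      + 1 / 2 * ∫ t in Ioo a b, (step x α (m + 1) t - v t) ^ 2
      = lam * (∑ i ∈ Finset.range m, |α (i + 1) - α i|)
        + 1 / 2 * ∫ t in Ioo a b, (step x d (m + 1) t - v t) ^ 2 := by
    rw [hsplit, discreteEnergy]; ring
  rw [hsum, ofReal_energy_eq hlam (Finset.sum_nonneg fun _ _ => abs_nonneg _)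
    (integral_nonneg fun _ => sq_nonneg _), energy, hlint,
    ofReal_integral_eq_lintegral_ofReal hsq (Filter.Eventually.of_forall fun _ => sq_nonneg _)]
  exact add_le_add_left (mul_le_mul_right (ofReal_sum_abs_mean_le h hv) _) _

/-- The surplus square in `ofReal_discreteEnergy_mean_le` forces any minimizer to equal its
averages, and these minimize the discrete energy, whose minimizer is unique on the indices that
matter. -/
theorem exists_isDenoised_step (h : IsGrid a b (m + 1) x) {d : ℕ → ℝ} {f : ℝ → ℝ}
    (hf : f =ᵐ[volume.restrict (Ioo a b)] step x d (m + 1)) (hlam : 0 ≤ lam) :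
    ∃ c, IsDenoised a b f lam (step x c (m + 1)) ∧ ∀ v, IsDenoised a b f lam v →
      v =ᵐ[volume.restrict (Ioo a b)] step x c (m + 1) := by
  obtain ⟨c, hc⟩ := exists_forall_discreteEnergy_le h d hlam
  have hbv : step x c (m + 1) ∈ BV a b :=
    ⟨integrableOn_step a b x c _, (totalVariation_step_le h c).trans_lt ENNReal.ofReal_lt_top⟩
  refine ⟨c, ⟨hbv, fun v hv => ?_⟩, fun v hv => ?_⟩
  · show energy a b f lam (step x c (m + 1)) ≤ energy a b f lam v
    by_cases hE : energy a b f lam v = ⊤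
    · rw [hE]; exact le_top
    refine (energy_step_le h hf hlam c).trans ((ENNReal.ofReal_le_ofReal ?_).trans
      (ofReal_discreteEnergy_mean_le h hf hlam hv.1 hE).2)
    exact (hc (mean x v)).trans (le_add_of_nonneg_right
      (mul_nonneg (by norm_num) (integral_nonneg fun _ => sq_nonneg _)))
  · have hle : energy a b f lam v ≤ ENNReal.ofReal (discreteEnergy x d lam m c) :=
      (hv.2 hbv).trans (energy_step_le h hf hlam c)
    obtain ⟨hv2, hlow⟩ := ofReal_discreteEnergy_mean_le h hf hlam hv.1.1
      (hle.trans_lt ENNReal.ofReal_lt_top).ne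
    have hreal := (ENNReal.ofReal_le_ofReal_iff (discreteEnergy_nonneg h d hlam c)).1
      (hlow.trans hle)
    have hnn : 0 ≤ ∫ t in Ioo a b, (step x (mean x v) (m + 1) t - v t) ^ 2 :=
      integral_nonneg fun _ => sq_nonneg _
    have hzero : ∫ t in Ioo a b, (step x (mean x v) (m + 1) t - v t) ^ 2 = 0 :=
      le_antisymm (by linarith [hc (mean x v)]) hnn
    have hw : MemLp (fun t => step x (mean x v) (m + 1) t - v t) 2 (volume.restrict (Ioo a b)) :=
      (memLp_step a b x _ (m + 1) 2).sub hv2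
    have hae := (integral_eq_zero_iff_of_nonneg (fun _ => sq_nonneg _) hw.integrable_sq).1 hzero
    rw [← step_congr (x := x) fun i hi => eq_of_discreteEnergy_le h d hlam hc (c' := mean x v)
      (by linarith) hi]
    filter_upwards [hae] with t ht
    exact (sub_eq_zero.1 (pow_eq_zero_iff two_ne_zero |>.1 ht)).symm

end Step

end ROF

/-! ### The dual problem for small parameters -/

namespace ROF

section Dual

variable {a b lam : ℝ} {n m : ℕ} {x : ℕ → ℝ}

/-- The slopes of the piecewise linear interpolation of `p` on a grid. -/
noncomputable def slope (x p : ℕ → ℝ) (i : ℕ) : ℝ := (p (i + 1) - p i) / (x (i + 1) - x i)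

theorem slope_mul (h : IsGrid a b n x) (p : ℕ → ℝ) {i : ℕ} (hi : i < n) :
    slope x p i * (x (i + 1) - x i) = p (i + 1) - p i :=
  div_mul_cancel₀ _ (sub_pos.2 (h.lt_succ i hi)).ne'

/-- The piecewise linear function with the value `p i` at the node `x i` for `i ≤ n`. -/
noncomputable def linInterp (x p : ℕ → ℝ) (n : ℕ) : ℝ → ℝ :=
  interp (fun s => max 0 (min 1 s)) x p n

theorem clamp_of_nonpos (s : ℝ) (hs : s ≤ 0) : max 0 (min 1 s) = 0 :=
  max_eq_left (min_le_of_right_le hs)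

theorem clamp_of_one_le (s : ℝ) (hs : 1 ≤ s) : max 0 (min 1 s) = 1 := by
  rw [min_eq_left hs, max_eq_right zero_le_one]

theorem continuous_linInterp (x p : ℕ → ℝ) (n : ℕ) : Continuous (linInterp x p n) := by
  unfold linInterp interp; fun_prop

theorem linInterp_apply (h : IsGrid a b n x) {p : ℕ → ℝ} (hp0 : p 0 = 0) {k : ℕ} (hk : k < n)
    {t : ℝ} (ht : t ∈ Icc (x k) (x (k + 1))) :
    linInterp x p n t = p k + slope x p k * (t - x k) := by
  have hl := sub_pos.2 (h.lt_succ k hk)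
  rw [linInterp, interp_apply h p clamp_of_nonpos clamp_of_one_le hk ht, hp0, one_mul, sub_zero,
    min_eq_right, max_eq_right, slope]
  · ring
  · exact div_nonneg (sub_nonneg.2 ht.1) hl.le
  · rw [div_le_one hl]; linarith [ht.2]

theorem linInterp_left (h : IsGrid a b n x) (p : ℕ → ℝ) : linInterp x p n a = 0 :=
  interp_of_le h p clamp_of_nonpos le_rfl

theorem linInterp_right (h : IsGrid a b n x) {p : ℕ → ℝ} (hp0 : p 0 = 0) (hpn : p n = 0) :
    linInterp x p n b = 0 := by
  rw [linInterp, interp_of_ge h p clamp_of_one_le le_rfl, hp0, hpn, sub_zero, mul_zero]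

theorem abs_linInterp_le (h : IsGrid a b n x) (hn : 0 < n) {p : ℕ → ℝ} (hp0 : p 0 = 0)
    (hp : ∀ i ≤ n, |p i| ≤ 1) {t : ℝ} (ht : t ∈ Icc a b) : |linInterp x p n t| ≤ 1 :=
  abs_interp_le h hn hp0 hp clamp_of_nonpos clamp_of_one_le
    (fun _ => ⟨le_max_left _ _, max_le zero_le_one (min_le_left _ _)⟩) le_rfl ht

theorem piecewiseLinear_linInterp (h : IsGrid a b n x) {p : ℕ → ℝ} (hp0 : p 0 = 0) :
    PiecewiseLinear a b (linInterp x p n) := by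
  refine ⟨n, fun i => x i, fun i => slope x p i, fun i => p i - slope x p i * x i,
    h.isPartition, fun i t ht => ?_⟩
  rw [linInterp_apply h hp0 i.2 (by simpa using ht)]
  ring

/-- The increments telescope to `p k` at the nodes, and the integrand is constant in between. -/
theorem integral_step_slope (h : IsGrid a b n x) {p : ℕ → ℝ} (hp0 : p 0 = 0) (hn : 0 < n) {t : ℝ}
    (ht : t ∈ Icc a b) : ∫ s in a..t, step x (slope x p) n s = linInterp x p n t := by
  have hi : ∀ u v, IntervalIntegrable (step x (slope x p) n) volume u v := fun u v =>
    ⟨(integrableOn_step (u - 1) (v + 1) x _ n).mono_set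
      fun r hr => ⟨by linarith [hr.1], by linarith [hr.2]⟩,
      (integrableOn_step (v - 1) (u + 1) x _ n).mono_set
      fun r hr => ⟨by linarith [hr.1], by linarith [hr.2]⟩⟩
  have hnode : ∀ k ≤ n, ∫ s in a..(x k), step x (slope x p) n s = p k := by
    intro k
    induction k with
    | zero => intro _; rw [h.left, intervalIntegral.integral_same, hp0]
    | succ k ih =>
      intro hk
      rw [← intervalIntegral.integral_add_adjacent_intervals (hi _ (x k)) (hi _ _),
        ih (by omega), integral_step h _ hk, slope_mul h p hk]
      ring
  obtain ⟨k, hk, htk⟩ := h.exists_mem_Icc hn ht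
  rw [← intervalIntegral.integral_add_adjacent_intervals (hi _ (x k)) (hi _ _), hnode k hk.le,
    linInterp_apply h hp0 hk htk, ← setIntegral_Ioo_eq htk.1,
    setIntegral_congr_fun measurableSet_Ioo (fun s hs => step_apply h _ hk
      (Ioo_subset_Ioo_right htk.2 hs)), setIntegral_const]
  simp [htk.1, mul_comm]

theorem hasDistribDeriv_linInterp (hab : a ≤ b) (h : IsGrid a b n x) {p : ℕ → ℝ} (hp0 : p 0 = 0)
    (hn : 0 < n) : HasDistribDeriv a b (linInterp x p n) (step x (slope x p) n) := by
  intro φ hφ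
  rw [← hasDistribDeriv_primitive hab (integrableOn_step a b x (slope x p) n) φ hφ]
  refine setIntegral_congr_fun measurableSet_Ioo fun t ht => ?_
  simp only [integral_step_slope h hp0 hn (Ioo_subset_Icc_self ht)]

theorem linInterp_mem_K (hab : a ≤ b) (h : IsGrid a b n x) {p : ℕ → ℝ} (hp0 : p 0 = 0)
    (hpn : p n = 0) (hn : 0 < n) (hp : ∀ i ≤ n, |p i| ≤ 1) : linInterp x p n ∈ K a b := by
  have hc := continuous_linInterp x p n
  refine ⟨⟨⟨?_, _, memLp_step a b x _ n 2, hasDistribDeriv_linInterp hab h hp0 hn⟩,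
    hc.continuousOn, linInterp_left h p, linInterp_right h hp0 hpn⟩,
    fun t ht => abs_linInterp_le h hn hp0 hp ht⟩
  refine MemLp.of_bound hc.aestronglyMeasurable 1 ?_
  refine (ae_restrict_iff' measurableSet_Ioo).2 (Filter.Eventually.of_forall fun t ht => ?_)
  exact abs_linInterp_le h hn hp0 hp (Ioo_subset_Icc_self ht)

theorem distribDeriv_linInterp (hab : a ≤ b) (h : IsGrid a b n x) {p : ℕ → ℝ} (hp0 : p 0 = 0)
    (hpn : p n = 0) (hn : 0 < n) (hp : ∀ i ≤ n, |p i| ≤ 1) :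
    distribDeriv a b (linInterp x p n) =ᵐ[volume.restrict (Ioo a b)] step x (slope x p) n := by
  have hs := (linInterp_mem_K hab h hp0 hpn hn hp).1.1.distribDeriv_spec
  exact hs.2.ae_unique (hasDistribDeriv_linInterp hab h hp0 hn) hs.1.integrableOn
    (integrableOn_step a b x _ n)

/-- By parts, node `i + 1` contributes the jump of `u` times `sign (d (i + 1) - d i) + η (x (i +
1))`. Since `|η| ≤ 1` and the sign is `±1`, the second factor is zero or has that sign, and so does
the jump of `u`. A zero jump of `d` would break this. -/
theorem zero_le_sum_jumpSign (h : IsGrid a b (m + 1) x) {d u : ℕ → ℝ}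
    (hu : ∀ i < m, 0 ≤ (SignType.sign (d (i + 1) - d i) : ℝ) * (u (i + 1) - u i)
      ∧ d (i + 1) ≠ d i) {η : ℝ → ℝ} (hη : η ∈ K a b) :
    0 ≤ ∑ i ∈ Finset.range (m + 1), u i * ((jumpSign d m (i + 1) - η (x (i + 1)))
      - (jumpSign d m i - η (x i))) := by
  rw [sum_mul_sub_eq u (fun i => jumpSign d m i - η (x i)), jumpSign_zero, jumpSign_last, h.left,
    h.right, hη.1.2.2.1, hη.1.2.2.2, sub_zero, mul_zero, mul_zero, sub_zero, zero_sub,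
    ← Finset.sum_neg_distrib]
  refine Finset.sum_nonneg fun i hi => ?_
  have hi := Finset.mem_range.1 hi
  rw [jumpSign_succ d hi]
  have hη1 := abs_le.1 (hη.2 (x (i + 1)) (h.mem_Icc (by omega)))
  obtain ⟨h1, h2⟩ := hu i hi
  rcases lt_or_gt_of_ne h2 with h3 | h3
  · rw [sign_neg (sub_neg.2 h3)] at h1 ⊢
    simp only [SignType.coe_neg_one] at h1 ⊢
    nlinarith [hη1.2]
  · rw [sign_pos (sub_pos.2 h3)] at h1 ⊢
    simp only [SignType.coe_one] at h1 ⊢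
    nlinarith [hη1.1]

/-- If subtracting `lam` times the derivative of the interpolation of the jump signs from the data
preserves the direction of all jumps, then that interpolation maximizes the dual functional, with
quadratic growth. -/
theorem dualEnergy_add_le (hab : a < b) (h : IsGrid a b (m + 1) x) {d : ℕ → ℝ} {f : ℝ → ℝ}
    (hf : f =ᵐ[volume.restrict (Ioo a b)] step x d (m + 1)) (hlam : 0 ≤ lam)
    (hu : ∀ i < m, 0 ≤ (SignType.sign (d (i + 1) - d i) : ℝ)
      * ((d (i + 1) - lam * slope x (jumpSign d m) (i + 1)) - (d i - lam * slope x (jumpSign d m) i))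
      ∧ d (i + 1) ≠ d i) {η : ℝ → ℝ} (hη : η ∈ K a b) :
    dualEnergy a b f lam η + lam ^ 2 / 2 * ∫ t in Ioo a b,
        (step x (slope x (jumpSign d m)) (m + 1) t - distribDeriv a b η t) ^ 2
      ≤ dualEnergy a b f lam (linInterp x (jumpSign d m) (m + 1)) := by
  set p := jumpSign d m
  set s := slope x p
  set g := distribDeriv a b η
  obtain ⟨hg2, hgd⟩ := hη.1.1.distribDeriv_spec
  have hg1 := hg2.integrableOn
  have hw : MemLp (fun t => step x s (m + 1) t - g t) 2 (volume.restrict (Ioo a b)) :=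
    (memLp_step a b x s (m + 1) 2).sub hg2
  have hwi : IntegrableOn (fun t => step x s (m + 1) t - g t) (Ioo a b) :=
    (integrableOn_step a b x s (m + 1)).sub hg1
  have hξ := distribDeriv_linInterp hab.le h (jumpSign_zero d m) (jumpSign_last d m) m.succ_pos
    fun i _ => abs_jumpSign_le d m i
  let u : ℕ → ℝ := fun i => d i - lam * s i
  -- This is the variational inequality characterizing the projection of `f` onto the convex set of
  -- all `lam * η'` with `η` in `K`.
  have hcross : 0 ≤ ∫ t in Ioo a b, step x u (m + 1) t * (step x s (m + 1) t - g t) := by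
    rw [integral_step_mul h u hwi]
    refine (zero_le_sum_jumpSign h (u := u) hu hη).trans_eq (Finset.sum_congr rfl fun i hi => ?_)
    have hi := Finset.mem_range.1 hi
    have hl := (h.lt_succ i hi).le
    rw [intervalIntegral.integral_sub
      (intervalIntegrable_of_Ioo hl (integrableOn_step _ _ x s _))
      (intervalIntegrable_of_Ioo hl (hg1.mono_set (h.Ioo_subset hi))), integral_step h s hi,
      slope_mul h p hi, hgd.integral_eq_sub hab hη.1.2.1 hg1 (h.mem_Icc hi.le) (h.mem_Icc hi)]
    ring
  have e1 : ∫ t in Ioo a b, (f t - lam * distribDeriv a b (linInterp x p (m + 1)) t) ^ 2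
      = ∫ t in Ioo a b, step x u (m + 1) t ^ 2 := by
    refine integral_congr_ae ?_
    filter_upwards [hf, hξ, h.ae_exists_mem_Ioo m.succ_pos] with t h1 h2 ⟨k, hk, hm⟩
    rw [h1, h2, step_apply h _ hk hm, step_apply h _ hk hm, step_apply h _ hk hm]
  have e2 : ∫ t in Ioo a b, (f t - lam * g t) ^ 2
      = (∫ t in Ioo a b, step x u (m + 1) t ^ 2)
        + 2 * lam * (∫ t in Ioo a b, step x u (m + 1) t * (step x s (m + 1) t - g t))
        + lam ^ 2 * ∫ t in Ioo a b, (step x s (m + 1) t - g t) ^ 2 := by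
    have e : (fun t => (f t - lam * g t) ^ 2) =ᵐ[volume.restrict (Ioo a b)] fun t =>
        step x u (m + 1) t ^ 2
          + 2 * lam * (step x u (m + 1) t * (step x s (m + 1) t - g t))
          + lam ^ 2 * (step x s (m + 1) t - g t) ^ 2 := by
      filter_upwards [hf, h.ae_exists_mem_Ioo m.succ_pos] with t h1 ⟨k, hk, hm⟩
      rw [h1, step_apply h _ hk hm, step_apply h _ hk hm, step_apply h _ hk hm]
      ring
    have i1 := (memLp_step a b x u (m + 1) 2).integrable_sq
    have i2 := (integrableOn_step_mul (x := x) (n := m + 1) u hwi).const_mul (2 * lam)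
    have i12 : Integrable (fun t => step x u (m + 1) t ^ 2
        + 2 * lam * (step x u (m + 1) t * (step x s (m + 1) t - g t)))
        (volume.restrict (Ioo a b)) := i1.add i2
    rw [integral_congr_ae e, integral_add i12 (hw.integrable_sq.const_mul _), integral_add i1 i2,
      integral_const_mul, integral_const_mul]
  rw [dualEnergy, dualEnergy, e1, e2]
  linarith [mul_nonneg hlam hcross]

/-- For small `lam` the direction of the jumps of `d` is not affected by a perturbation. -/
theorem exists_forall_sign_mul_nonneg {d : ℕ → ℝ} (hd : ∀ i < m, d (i + 1) ≠ d i) (s : ℕ → ℝ) :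
    ∃ lamBar : ℝ, 0 < lamBar ∧ ∀ lam, 0 < lam → lam ≤ lamBar → ∀ i < m,
      0 ≤ (SignType.sign (d (i + 1) - d i) : ℝ)
        * ((d (i + 1) - lam * s (i + 1)) - (d i - lam * s i)) := by
  let S : ℝ := ∑ i ∈ Finset.range m, |s (i + 1) - s i| / |d (i + 1) - d i|
  have hS : 0 ≤ S := Finset.sum_nonneg fun _ _ => div_nonneg (abs_nonneg _) (abs_nonneg _)
  -- What is needed is `lam * |s (i + 1) - s i| ≤ |d (i + 1) - d i|` for all `i < m`; `S` dominates
  -- all the ratios, and the `1 +` covers `S = 0`.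
  refine ⟨1 / (1 + S), by positivity, fun lam h0 hlam i hi => ?_⟩
  have hpos : 0 < |d (i + 1) - d i| := abs_pos.2 (sub_ne_zero.2 (hd i hi))
  have hiS : |s (i + 1) - s i| / |d (i + 1) - d i| ≤ S :=
    Finset.single_le_sum (f := fun i => |s (i + 1) - s i| / |d (i + 1) - d i|)
      (fun _ _ => div_nonneg (abs_nonneg _) (abs_nonneg _)) (Finset.mem_range.2 hi)
  rw [div_le_iff₀ hpos] at hiS
  rw [le_div_iff₀ (by positivity)] at hlam
  have hle : lam * |s (i + 1) - s i| ≤ |d (i + 1) - d i| := by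
    calc lam * |s (i + 1) - s i| ≤ lam * (S * |d (i + 1) - d i|) :=
          mul_le_mul_of_nonneg_left hiS h0.le
      _ = (lam * S) * |d (i + 1) - d i| := by ring
      _ ≤ 1 * |d (i + 1) - d i| := mul_le_mul_of_nonneg_right (by linarith) (abs_nonneg _)
      _ = _ := one_mul _
  have e : (d (i + 1) - lam * s (i + 1)) - (d i - lam * s i)
      = (d (i + 1) - d i) - lam * (s (i + 1) - s i) := by ring
  rw [e, mul_sub, sign_mul_self]
  have hsgn : (SignType.sign (d (i + 1) - d i) : ℝ) * (lam * (s (i + 1) - s i))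
      ≤ lam * |s (i + 1) - s i| := by
    refine (le_abs_self _).trans ?_
    rw [abs_mul, abs_mul, abs_of_pos h0]
    refine mul_le_of_le_one_left (by positivity) ?_
    rcases SignType.sign (d (i + 1) - d i) with _ | _ | _ <;> simp
  linarith

/-- Quadratic growth makes the derivatives of two maximizers agree almost everywhere, and both
functions vanish at `a`. -/
theorem IsDualSolution.eqOn_linInterp (hab : a < b) (h : IsGrid a b (m + 1) x) {d : ℕ → ℝ}
    {f : ℝ → ℝ} (hf : f =ᵐ[volume.restrict (Ioo a b)] step x d (m + 1)) (hlam : 0 < lam)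
    (hu : ∀ i < m, 0 ≤ (SignType.sign (d (i + 1) - d i) : ℝ)
      * ((d (i + 1) - lam * slope x (jumpSign d m) (i + 1)) - (d i - lam * slope x (jumpSign d m) i))
      ∧ d (i + 1) ≠ d i) {η : ℝ → ℝ} (hη : IsDualSolution a b f lam η) :
    EqOn η (linInterp x (jumpSign d m) (m + 1)) (Icc a b) := by
  have hK := linInterp_mem_K hab.le h (jumpSign_zero d m) (jumpSign_last d m) m.succ_pos
    fun i _ => abs_jumpSign_le d m i
  have hle := dualEnergy_add_le hab h hf hlam.le hu hη.1
  have hge : dualEnergy a b f lam (linInterp x (jumpSign d m) (m + 1)) ≤ dualEnergy a b f lam η :=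
    hη.2 hK
  obtain ⟨hg2, hgd⟩ := hη.1.1.1.distribDeriv_spec
  have hw : MemLp (fun t => step x (slope x (jumpSign d m)) (m + 1) t - distribDeriv a b η t) 2
      (volume.restrict (Ioo a b)) := (memLp_step a b x _ (m + 1) 2).sub hg2
  have hzero : ∫ t in Ioo a b,
      (step x (slope x (jumpSign d m)) (m + 1) t - distribDeriv a b η t) ^ 2 = 0 := by
    refine le_antisymm ?_ (integral_nonneg fun _ => sq_nonneg _)
    by_contra! hc
    have : 0 < lam ^ 2 / 2 * ∫ t in Ioo a b,
      (step x (slope x (jumpSign d m)) (m + 1) t - distribDeriv a b η t) ^ 2 :=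
      mul_pos (by positivity) hc
    linarith
  have hae := (integral_eq_zero_iff_of_nonneg (fun _ => sq_nonneg _) hw.integrable_sq).1 hzero
  intro t ht
  have h1 := hgd.integral_eq_sub hab hη.1.1.2.1 hg2.integrableOn (left_mem_Icc.2 hab.le) ht
  rw [hη.1.1.2.2.1, sub_zero] at h1
  rw [← h1, ← integral_step_slope h (jumpSign_zero d m) m.succ_pos ht, ← setIntegral_Ioo_eq ht.1,
    ← setIntegral_Ioo_eq ht.1]
  refine integral_congr_ae (ae_restrict_of_ae_restrict_of_subset (Ioo_subset_Ioo_right ht.2) ?_)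
  filter_upwards [hae] with r hr
  exact (sub_eq_zero.1 (pow_eq_zero_iff two_ne_zero |>.1 hr)).symm

end Dual

end ROF

theorem mainTheorem11 (a b : ℝ) (hab : a < b) (f : ℝ → ℝ) (hf : ROF.PiecewiseConstant a b f) :
    (∀ lam : ℝ, 0 < lam →
      ∃ u : ℝ → ℝ, ROF.IsDenoised a b f lam u ∧
        (∀ v : ℝ → ℝ, ROF.IsDenoised a b f lam v → v =ᵐ[volume.restrict (Ioo a b)] u) ∧
        ROF.PiecewiseConstant a b u) ∧
    ∃ lamBar : ℝ, 0 < lamBar ∧ ∃ ξBar ∈ ROF.K a b, ROF.PiecewiseLinear a b ξBar ∧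
      ∀ lam : ℝ, 0 < lam → lam ≤ lamBar →
        ROF.IsDualSolution a b f lam ξBar ∧
          ∀ ξ : ℝ → ℝ, ROF.IsDualSolution a b f lam ξ → EqOn ξ ξBar (Icc a b) := by
  -- The nonvanishing of the jumps `hd` is used only for the dual part.
  obtain ⟨m, x, d, hx, hfd, hd⟩ := hf.exists_step hab
  constructor
  · intro lam hlam
    obtain ⟨c, hc, huniq⟩ := ROF.exists_isDenoised_step hx hfd hlam.le
    exact ⟨_, hc, huniq, ROF.piecewiseConstant_step hx c⟩
  · obtain ⟨lamBar, h0, hbar⟩ :=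
      ROF.exists_forall_sign_mul_nonneg hd (ROF.slope x (ROF.jumpSign d m))
    have hK := ROF.linInterp_mem_K hab.le hx (ROF.jumpSign_zero d m) (ROF.jumpSign_last d m)
      m.succ_pos fun i _ => ROF.abs_jumpSign_le d m i
    refine ⟨lamBar, h0, _, hK, ROF.piecewiseLinear_linInterp hx (ROF.jumpSign_zero d m),
      fun lam hpos hle => ?_⟩
    have hu := fun i hi => And.intro (hbar lam hpos hle i hi) (hd i hi)
    refine ⟨⟨hK, fun η hη => ?_⟩, fun η hη => hη.eqOn_linInterp hab hx hfd hpos hu⟩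
    have := ROF.dualEnergy_add_le hab hx hfd hpos.le hu hη
    exact le_trans (le_add_of_nonneg_right
      (mul_nonneg (by positivity) (integral_nonneg fun _ => sq_nonneg _))) this
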